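/- A *contraction semigroup* on a Hilbert space $H$ is a family $P=(P_t)_{t\ge 0}$ of bounded linear operators on $H$ with $P_0=I$, $P_{t+s}=P_tP_s$, $\|P_t\|\le 1$ and $\lim_{t\to 0}\|P_tf-f\|=0$ for all $f\in H$. We write $P=(e^{-tA})_{t\ge0}$ when $-A$ is the generator of $P$, that is, $-Af=\lim_{t\downarrow 0}(P_tf-f)/t$ on the domain of all $f$ for which this limit exists. Let $P_\infty$ be the orthogonal projection onto $\{f: P_tf=f\ \forall t\ge0\}$. We say that $P$ *converges to equilibrium with rate $r(t)$* if $r(t)\to0$ as $t\to\infty$ and, for all $t$ large enough and all $f\in H$, $\|P_tf-P_\infty f\|\le r(t)\|f-P_\infty f\|$; and that $P$ satisfies a *hypocoercive estimate with constants $C\ge1$ and $\lambda>0$* if $\|P_tf-P_\infty f\|\le Ce^{-\lambda t}\|f-P_\infty f\|$ for all $f\in H$ and $t\ge0$. **Proposition.** Let $P$ and $\tilde P=(e^{-t\tilde A})_{t\ge 0}$ be contraction semigroups on (real or complex) Hilbert spaces $H$ and $K$, and suppose that $\Lambda:K\to H$ is a bounded linear bijection with $P_t=\Lambda\tilde P_t\Lambda^{-1}$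 for all $t\ge0$. Let $\kappa(\Lambda)=\|\Lambda\|\,\|\Lambda^{-1}\|$. 1. If $\tilde P$ converges to equilibrium with rate $r(t)$, then $P$ converges to equilibrium with rate $\kappa(\Lambda)r(t)$. 2. If $H\neq\{0\}$ and $\tilde P$ satisfies a hypocoercive estimate with constants $C\ge1$ and $\lambda>0$, then $P$ satisfies a hypocoercive estimate with constants $C\kappa(\Lambda)$ and $\lambda$. 3. If $H$ and $K$ are complex and $\tilde P$ is normal, that is, $\tilde A$ is densely defined with $\tilde A\tilde A^*=\tilde A^*\tilde A$, then $P=(e^{-tA})_{t\ge0}$ is a scalar, spectral operator in the sense of Dunford: there is a map $F$ from the Borel subsets of $\mathbb C$ to the bounded operators on $H$ (not necessarily self-adjoint) with $F_\emptyset=0$, $F_{\mathbb C}=I$, $F_{\Omega_1}F_{\Omega_2}=F_{\Omega_1\cap\Omega_2}$, countably additive in the strong operator topology, such that $\sup_\Omega\|F_\Omega\|<\infty$, every $F_\Omega$ commutes with every $P_t$, and, for all $t\ge0$, $$P_t=\int_{\sigma(A)}e^{-\gamma t}\,dF_\gamma ,$$ that is, $\langle P_tf,g\rangle=\int_{\sigma(A)}e^{-\gamma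 t}\,d\langle F_\gamma f,g\rangle$ for all $f,g\in H$. -/

import Mathlib

open Filter Topology MeasureTheory
open scoped NNReal LinearPMap

noncomputable section

/-- A strongly continuous contraction semigroup `(P_t)_{t ≥ 0}` on a Hilbert space. -/
structure ContractionSemigroup (𝕜 : Type*) (H : Type*) [RCLike 𝕜] [NormedAddCommGroup H]
    [InnerProductSpace 𝕜 H] where
  /-- the operator `P_t` -/
  op : ℝ≥0 → H →L[𝕜] H
  op_zero : op 0 = ContinuousLinearMap.id 𝕜 H
  op_add : ∀ s t, op (s + t) = (op s).comp (op t)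
  norm_op_le_one : ∀ t, ‖op t‖ ≤ 1
  tendsto_zero : ∀ f : H, Tendsto (fun t => ‖op t f - f‖) (𝓝 0) (𝓝 0)

namespace ContractionSemigroup

section Generic

variable {𝕜 H : Type*} [RCLike 𝕜] [NormedAddCommGroup H] [InnerProductSpace 𝕜 H]
  (P : ContractionSemigroup 𝕜 H)

/-- The difference quotient `(P_t f - f) / t`. -/
def diffQuot (f : H) (t : ℝ≥0) : H := (((t : ℝ) : 𝕜))⁻¹ • (P.op t f - f)

/-- The domain of the generator: all `f` for which `(P_t f - f) / t` has a limit as `t ↓ 0`. -/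
def generatorDomain : Submodule 𝕜 H where
  carrier := {f | ∃ g, Tendsto (P.diffQuot f) (𝓝[>] 0) (𝓝 g)}
  zero_mem' := ⟨0, by
    have h : P.diffQuot 0 = fun _ => (0 : H) := by
      funext t
      simp [diffQuot]
    rw [h]
    exact tendsto_const_nhds⟩
  add_mem' := by
    rintro f₁ f₂ ⟨g₁, h₁⟩ ⟨g₂, h₂⟩
    refine ⟨g₁ + g₂, (h₁.add h₂).congr fun t => ?_⟩
    simp only [diffQuot, map_add, ← smul_add]
    congr 1
    abel
  smul_mem' := by
    rintro c f ⟨g, h⟩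
    refine ⟨c • g, (h.const_smul c).congr fun t => ?_⟩
    simp only [diffQuot, map_smul, ← smul_sub]
    rw [smul_comm]

/-- The infinitesimal generator of `P`. -/
def generator : H →ₗ.[𝕜] H where
  domain := P.generatorDomain
  toFun :=
    { toFun := fun f => Classical.choose f.2
      map_add' := by
        intro f₁ f₂
        refine tendsto_nhds_unique (Classical.choose_spec (f₁ + f₂).2) ?_
        refine ((Classical.choose_spec f₁.2).add (Classical.choose_spec f₂.2)).congr fun t => ?_
        simp only [diffQuot, Submodule.coe_add, map_add, ← smul_add]
        congr 1
        abel
      map_smul' := by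
        intro c f
        refine tendsto_nhds_unique (Classical.choose_spec (c • f).2) ?_
        refine ((Classical.choose_spec f.2).const_smul c).congr fun t => ?_
        simp only [diffQuot, Submodule.coe_smul, map_smul, ← smul_sub]
        rw [smul_comm] }

/-- The operator `A` for which `P = (e^{-tA})_{t ≥ 0}`: the generator of `P` is `-A`. -/
def operatorA : H →ₗ.[𝕜] H := -P.generator

/-- The subspace `{f : P_t f = f for all t ≥ 0}` of invariant vectors. -/
def invariants : Submodule 𝕜 H where
  carrier := {f | ∀ t, P.op t f = f}
  zero_mem' := fun t => map_zero _
  add_mem' := fun {f g} hf hg t => by rw [map_add, hf t, hg t]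
  smul_mem' := fun c f hf t => by rw [map_smul, hf t]

theorem isClosed_invariants : IsClosed (P.invariants : Set H) := by
  have h : (P.invariants : Set H) = ⋂ t, {f | P.op t f = f} := by
    ext f
    simp [invariants]
  rw [h]
  exact isClosed_iInter fun t => isClosed_eq (P.op t).continuous continuous_id

instance instHasOrthogonalProjectionInvariants [CompleteSpace H] :
    P.invariants.HasOrthogonalProjection :=
  haveI : CompleteSpace P.invariants := P.isClosed_invariants.completeSpace_coe
  inferInstance

/-- `P_∞`, the orthogonal projection onto the space of invariant vectors. -/
def limitProj [CompleteSpace H] : H →L[𝕜] H := P.invariants.starProjection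

/-- `P` converges to equilibrium with rate `r`: `r(t) → 0` as `t → ∞`, and, for `t` large enough,
`‖P_t f - P_∞ f‖ ≤ r(t) ‖f - P_∞ f‖` for all `f`. -/
def ConvergesWithRate [CompleteSpace H] (r : ℝ≥0 → ℝ) : Prop :=
  Tendsto r atTop (𝓝 0) ∧
    ∀ᶠ t in atTop, ∀ f : H, ‖P.op t f - P.limitProj f‖ ≤ r t * ‖f - P.limitProj f‖

/-- `P` satisfies a hypocoercive estimate with constants `C ≥ 1` and `γ > 0`. -/
def Hypocoercive [CompleteSpace H] (C γ : ℝ) : Prop :=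
  1 ≤ C ∧ 0 < γ ∧ ∀ (f : H) (t : ℝ≥0),
    ‖P.op t f - P.limitProj f‖ ≤ C * Real.exp (-γ * t) * ‖f - P.limitProj f‖

variable {K : Type*} [NormedAddCommGroup K] [InnerProductSpace 𝕜 K]

/-- `P` is similar to `Q` through `Λ`: `Λ` is a bounded bijection and `P_t = Λ Q_t Λ⁻¹` for all
`t ≥ 0`. Between Hilbert spaces, `Λ.inverse` is the inverse of the bijection `Λ`. -/
def SimilarVia (P : ContractionSemigroup 𝕜 H) (Q : ContractionSemigroup 𝕜 K)
    (Λ : K →L[𝕜] H) : Prop :=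
  Function.Bijective Λ ∧ ∀ t, P.op t = Λ.comp ((Q.op t).comp Λ.inverse)

end Generic

end ContractionSemigroup

/-- The condition number `κ(Λ) = ‖Λ‖ ‖Λ⁻¹‖` of a bounded bijection. -/
def conditionNumber {𝕜 H K : Type*} [RCLike 𝕜] [NormedAddCommGroup H] [InnerProductSpace 𝕜 H]
    [NormedAddCommGroup K] [InnerProductSpace 𝕜 K] (Λ : K →L[𝕜] H) : ℝ :=
  ‖Λ‖ * ‖Λ.inverse‖

section Complex

variable {H : Type*} [NormedAddCommGroup H] [InnerProductSpace ℂ H]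

/-- A densely defined operator is normal if `A A* = A* A`, as an equality of operators with their
natural domains, that is, of graphs. -/
def IsNormalOperator [CompleteSpace H] (A : H →ₗ.[ℂ] H) : Prop :=
  Dense (A.domain : Set H) ∧
    ∀ x y : H, (∃ z, (x, z) ∈ A†.graph ∧ (z, y) ∈ A.graph) ↔
      (∃ z, (x, z) ∈ A.graph ∧ (z, y) ∈ A†.graph)

/-- The spectrum of a (not necessarily bounded) operator: the set of all `z` for which `z - A` does
not have a bounded, everywhere defined two-sided inverse. -/
def operatorSpectrum (A : H →ₗ.[ℂ] H) : Set ℂ :=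
  {z | ¬ ∃ R : H →L[ℂ] H,
    (∀ x : H, ∃ h : R x ∈ A.domain, z • R x - A ⟨R x, h⟩ = x) ∧
    ∀ x : A.domain, R (z • (x : H) - A x) = x}

/-- A (not necessarily self-adjoint) resolution of the identity on the Borel sets of `ℂ`, with
values in the bounded operators on `H`. The values at non-measurable sets are irrelevant. -/
structure ResolutionOfIdentity (H : Type*) [NormedAddCommGroup H] [InnerProductSpace ℂ H] where
  /-- the operator `F_Ω` -/
  proj : Set ℂ → H →L[ℂ] H
  proj_empty : proj ∅ = 0
  proj_univ : proj Set.univ = ContinuousLinearMap.id ℂ H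
  proj_inter : ∀ Ω₁ Ω₂, MeasurableSet Ω₁ → MeasurableSet Ω₂ →
    (proj Ω₁).comp (proj Ω₂) = proj (Ω₁ ∩ Ω₂)
  proj_iUnion : ∀ Ω : ℕ → Set ℂ, (∀ i, MeasurableSet (Ω i)) →
    Pairwise (Function.onFun Disjoint Ω) →
    ∀ f : H, HasSum (fun i => proj (Ω i) f) (proj (⋃ i, Ω i) f)

namespace ResolutionOfIdentity

variable (F : ResolutionOfIdentity H)

open Classical in
/-- The complex measure `Ω ↦ ⟨F_Ω f, g⟩`, with the inner product linear in the entry `F_Ω f`. -/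
def scalarMeasure (f g : H) : ComplexMeasure ℂ where
  measureOf' Ω := if MeasurableSet Ω then inner ℂ g (F.proj Ω f) else 0
  empty' := by simp [F.proj_empty]
  not_measurable' := fun Ω hΩ => by simp [hΩ]
  m_iUnion' := by
    intro Ω hΩ hd
    have h := (F.proj_iUnion Ω hΩ hd f).mapL (innerSL ℂ g)
    simpa [hΩ, MeasurableSet.iUnion hΩ] using h

/-- `F` is uniformly bounded over the Borel sets. -/
def UniformlyBounded : Prop :=
  ∃ M : ℝ, ∀ Ω, MeasurableSet Ω → ‖F.proj Ω‖ ≤ M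

/-- `T = ∫_S m dF`, in the weak sense: for all `f` and `g`, the function `m` is integrable over `S`
with respect to the complex measure `⟨F f, g⟩` and `⟨T f, g⟩ = ∫_S m(γ) d⟨F_γ f, g⟩`. -/
def IsIntegral (S : Set ℂ) (m : ℂ → ℂ) (T : H →L[ℂ] H) : Prop :=
  MeasurableSet S ∧ ∀ f g : H,
    (F.scalarMeasure f g).IntegrableOn m S ∧
    inner ℂ g (T f) =
      VectorMeasure.integral ((F.scalarMeasure f g).restrict S) m (ContinuousLinearMap.mul ℝ ℂ)

end ResolutionOfIdentity

namespace ContractionSemigroup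

/-- A semigroup `P = (e^{-tA})_{t ≥ 0}` is normal if `A` is a normal operator. -/
def IsNormal [CompleteSpace H] (P : ContractionSemigroup ℂ H) : Prop :=
  IsNormalOperator P.operatorA

/-- `P` is spectral in the sense of Dunford, with resolution of the identity `F`: `F` is uniformly
bounded and commutes with `P`. -/
def IsSpectralWith (P : ContractionSemigroup ℂ H) (F : ResolutionOfIdentity H) : Prop :=
  F.UniformlyBounded ∧ ∀ t Ω, MeasurableSet Ω → Commute (P.op t) (F.proj Ω)

/-- `P = (e^{-tA})_{t ≥ 0}` is a scalar, spectral operator in the sense of Dunford: it is spectral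
with some resolution of the identity `F` for which `P_t = ∫_{σ(A)} e^{-γt} dF_γ` for all
`t ≥ 0`. -/
def IsScalarSpectral (P : ContractionSemigroup ℂ H) : Prop :=
  ∃ F : ResolutionOfIdentity H, P.IsSpectralWith F ∧
    ∀ t : ℝ≥0, F.IsIntegral (operatorSpectrum P.operatorA)
      (fun γ => Complex.exp (-γ * ((t : ℝ) : ℂ))) (P.op t)

end ContractionSemigroup

end Complex

end

noncomputable section

namespace ContractionSemigroup

/-! Equilibrium. The bijection `Λ` need not be unitary, so it has no evident reason to respect
orthogonal projections. It respects those onto the invariant vectors as soon as `Q_t` converges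
strongly to `Q_∞`: a vector fixed by a contraction is fixed by its adjoint, hence `P_∞ P_t = P_∞`,
and any limit of `P_t f` is invariant and therefore equal to `P_∞ f`. This gives `P_∞ Λ = Λ Q_∞`,
after which the estimates for `Q` pass to `P` at the cost of the factor `κ(Λ)`.

Spectral statement. The unbounded `A` is replaced by `R = (1 + A)⁻¹ = ∫ e^{-t} P_t dt`. Normality of
`A` makes `R` normal (`commute_adjoint_of_graph`). The continuous functional calculus `Φ` of `R`
gives measures `μ_f` by Riesz-Markov, and these give a projection-valued measure on `σ(R)`
(`exists_isSpectralProj`, `IsSpectralProj.inner_mul`). Its image under `w ↦ w⁻¹ - 1` is the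
resolution of the identity.

The function `e^{-t(w⁻¹ - 1)}` need not extend continuously to `w = 0`, but its product with `w`
does. Uniqueness for the Cauchy problem identifies that product with `Q_t R` (`op_mul_resolvent`).
As `R` is injective, `{w = 0}` is a null set, so the factor `w` can be removed by dominated
convergence (`inner_op_eq_integral`). Finally `Λ` conjugates the resolution of the identity, and
`σ(A)` is unchanged because it is read off from `σ(R)`. -/

theorem norm_op_apply_le {𝕜 H : Type*} [RCLike 𝕜] [NormedAddCommGroup H]
    [InnerProductSpace 𝕜 H] (P : ContractionSemigroup 𝕜 H) (t : ℝ≥0) (f : H) :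
    ‖P.op t f‖ ≤ ‖f‖ := by
  simpa using (P.op t).le_of_opNorm_le (P.norm_op_le_one t) f

/-! ### Convergence to equilibrium under similarity. -/

section Equilibrium

variable {𝕜 H K : Type*} [RCLike 𝕜]
  [NormedAddCommGroup H] [InnerProductSpace 𝕜 H] [CompleteSpace H]
  [NormedAddCommGroup K] [InnerProductSpace 𝕜 K] [CompleteSpace K]

/-- Invariant vectors of a contraction are invariant under its adjoint. -/
theorem _root_.ContinuousLinearMap.adjoint_apply_eq_self_of_norm_le_one {T : H →L[𝕜] H}
    (hT : ‖T‖ ≤ 1) {f : H} (hf : T f = f) : T.adjoint f = f := by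
  have h1 : ‖T.adjoint f‖ ≤ ‖f‖ := by
    simpa using T.adjoint.le_of_opNorm_le (c := 1) (by rwa [LinearIsometryEquiv.norm_map]) f
  -- Since `⟨T* f, f⟩ = ⟨f, T f⟩ = ‖f‖²`, the square expands to `‖T* f‖² - ‖f‖²`.
  have h2 : ‖T.adjoint f - f‖ ^ 2 ≤ 0 := by
    rw [@norm_sub_sq 𝕜, ContinuousLinearMap.adjoint_inner_left, hf, inner_self_eq_norm_sq]
    nlinarith [norm_nonneg (T.adjoint f), norm_nonneg f]
  have h3 : ‖T.adjoint f - f‖ = 0 := by nlinarith [norm_nonneg (T.adjoint f - f)]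
  exact sub_eq_zero.1 (norm_eq_zero.1 h3)

/-- For invariant `v`, `⟨v, P_t f⟩ = ⟨P_t* v, f⟩ = ⟨v, f⟩`, so `P_t f - f` is orthogonal to the
invariant vectors. -/
theorem limitProj_op (P : ContractionSemigroup 𝕜 H) (t : ℝ≥0) (f : H) :
    P.limitProj (P.op t f) = P.limitProj f := by
  rw [← sub_eq_zero, ← map_sub]
  refine (Submodule.starProjection_apply_eq_zero_iff _).2
    ((Submodule.mem_orthogonal _ _).2 fun v hv => ?_)
  rw [inner_sub_right, ← ContinuousLinearMap.adjoint_inner_left,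
    ContinuousLinearMap.adjoint_apply_eq_self_of_norm_le_one (P.norm_op_le_one t) (hv t), sub_self]

theorem limitProj_eq_of_tendsto (P : ContractionSemigroup 𝕜 H) {f p : H}
    (h : Tendsto (fun t => P.op t f) atTop (𝓝 p)) : P.limitProj f = p := by
  have hp : p ∈ P.invariants := by
    intro s
    refine tendsto_nhds_unique ((P.op s).continuous.continuousAt.tendsto.comp h) ?_
    refine (h.comp (tendsto_atTop_mono (fun t => le_add_self (a := t) (b := s)) tendsto_id)).congr fun t => ?_
    simp [P.op_add]
  have h1 : Tendsto (fun _ : ℝ≥0 => P.limitProj f) atTop (𝓝 (P.limitProj p)) :=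
    (P.limitProj.continuous.continuousAt.tendsto.comp h).congr fun t => P.limitProj_op t f
  rw [tendsto_nhds_unique tendsto_const_nhds h1]
  exact Submodule.starProjection_eq_self_iff.2 hp

variable {P : ContractionSemigroup 𝕜 H} {Q : ContractionSemigroup 𝕜 K} {Λ : K →L[𝕜] H}

theorem SimilarVia.exists_equiv (h : P.SimilarVia Q Λ) :
    ∃ e : K ≃L[𝕜] H, (e : K →L[𝕜] H) = Λ ∧ Λ.inverse = e.symm ∧
      ∀ t f, P.op t (e f) = e (Q.op t f) := by
  obtain ⟨hb, hop⟩ := h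
  let e := ContinuousLinearEquiv.ofBijective Λ (LinearMap.ker_eq_bot.2 hb.1)
    (LinearMap.range_eq_top.2 hb.2)
  have he : (e : K →L[𝕜] H) = Λ := ContinuousLinearEquiv.coe_ofBijective ..
  have hi : Λ.inverse = e.symm := by rw [← he, ContinuousLinearMap.inverse_equiv]
  refine ⟨e, he, hi, fun t f => ?_⟩
  rw [hop, hi, ← he]
  simp

theorem SimilarVia.limitProj_apply {e : K ≃L[𝕜] H}
    (he : ∀ t f, P.op t (e f) = e (Q.op t f))
    (hQ : ∀ g, Tendsto (fun t => Q.op t g) atTop (𝓝 (Q.limitProj g))) (g : K) :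
    P.limitProj (e g) = e (Q.limitProj g) := by
  apply P.limitProj_eq_of_tendsto
  simp only [he]
  exact e.continuous.continuousAt.tendsto.comp (hQ g)

theorem tendsto_limitProj_of_bound {r : ℝ≥0 → ℝ} (hr : Tendsto r atTop (𝓝 0))
    (h : ∀ᶠ t in atTop, ∀ f : K, ‖Q.op t f - Q.limitProj f‖ ≤ r t * ‖f - Q.limitProj f‖) (g : K) :
    Tendsto (fun t => Q.op t g) atTop (𝓝 (Q.limitProj g)) := by
  rw [tendsto_iff_norm_sub_tendsto_zero]
  refine squeeze_zero' (Eventually.of_forall fun _ => norm_nonneg _) (h.mono fun t ht => ht g) ?_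
  simpa using hr.mul_const ‖g - Q.limitProj g‖

theorem norm_sub_limitProj_le_of_similar {e : K ≃L[𝕜] H}
    (he : ∀ t f, P.op t (e f) = e (Q.op t f))
    (hl : ∀ g, P.limitProj (e g) = e (Q.limitProj g)) {t : ℝ≥0} {c : ℝ}
    (hc : ∀ f : K, ‖Q.op t f - Q.limitProj f‖ ≤ c * ‖f - Q.limitProj f‖) (f : H) :
    ‖P.op t f - P.limitProj f‖ ≤
      ‖(e : K →L[𝕜] H)‖ * ‖(e.symm : H →L[𝕜] K)‖ * c * ‖f - P.limitProj f‖ := by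
  obtain ⟨g, rfl⟩ := e.surjective f
  rw [he, hl, ← map_sub, ← map_sub]
  have h1 : ‖e (Q.op t g - Q.limitProj g)‖ ≤
      ‖(e : K →L[𝕜] H)‖ * ‖Q.op t g - Q.limitProj g‖ :=
    (e : K →L[𝕜] H).le_opNorm _
  have h2 : ‖g - Q.limitProj g‖ ≤
      ‖(e.symm : H →L[𝕜] K)‖ * ‖e (g - Q.limitProj g)‖ := by
    simpa using (e.symm : H →L[𝕜] K).le_opNorm (e (g - Q.limitProj g))
  have h3 := hc g
  -- The sign of `c` is not given. Either both sides vanish, or the bound `hc` at `g` forces `0 ≤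
  -- c`.
  by_cases h0 : ‖g - Q.limitProj g‖ = 0
  · have h4 : ‖Q.op t g - Q.limitProj g‖ = 0 :=
      le_antisymm (by rwa [h0, mul_zero] at h3) (norm_nonneg _)
    rw [norm_eq_zero.1 h0, norm_eq_zero.1 h4]
    simp
  · have hc0 : 0 ≤ c := by
      by_contra hneg
      have : c * ‖g - Q.limitProj g‖ < 0 :=
        mul_neg_of_neg_of_pos (not_le.1 hneg) (lt_of_le_of_ne (norm_nonneg _) (Ne.symm h0))
      linarith [norm_nonneg (Q.op t g - Q.limitProj g)]
    calc _ ≤ ‖(e : K →L[𝕜] H)‖ * (c * (‖(e.symm : H →L[𝕜] K)‖ * ‖e (g - Q.limitProj g)‖)) := by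
          refine h1.trans ?_
          gcongr
          exact h3.trans (by gcongr)
      _ = _ := by ring

theorem SimilarVia.convergesWithRate (h : P.SimilarVia Q Λ) {r : ℝ≥0 → ℝ}
    (hr : Q.ConvergesWithRate r) :
    P.ConvergesWithRate (fun t => conditionNumber Λ * r t) := by
  obtain ⟨e, rfl, hi, he⟩ := h.exists_equiv
  refine ⟨by simpa using hr.1.const_mul (conditionNumber (e : K →L[𝕜] H)), ?_⟩
  filter_upwards [hr.2] with t ht f
  rw [conditionNumber, hi]
  exact norm_sub_limitProj_le_of_similar he
    (SimilarVia.limitProj_apply he (tendsto_limitProj_of_bound hr.1 hr.2)) ht f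

theorem SimilarVia.hypocoercive (h : P.SimilarVia Q Λ) [Nontrivial H] {C γ : ℝ}
    (hQ : Q.Hypocoercive C γ) : P.Hypocoercive (C * conditionNumber Λ) γ := by
  obtain ⟨e, rfl, hi, he⟩ := h.exists_equiv
  obtain ⟨hC, hγ, hb⟩ := hQ
  -- On the zero space the condition number is `0`; nontriviality keeps the new constant at least
  -- `1`.
  have hκ : 1 ≤ conditionNumber (e : K →L[𝕜] H) := by
    have : Nontrivial K := e.symm.toEquiv.symm.nontrivial
    rw [conditionNumber, hi]
    exact e.one_le_norm_mul_norm_symm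
  refine ⟨by nlinarith, hγ, fun f t => ?_⟩
  have hlim : Tendsto (fun t : ℝ≥0 => C * Real.exp (-γ * t)) atTop (𝓝 0) := by
    have h1 : Tendsto (fun t : ℝ≥0 => γ * (t : ℝ)) atTop atTop :=
      (NNReal.tendsto_coe_atTop.2 tendsto_id).const_mul_atTop hγ
    simpa using (Real.tendsto_exp_neg_atTop_nhds_zero.comp h1).const_mul C
  have hl := SimilarVia.limitProj_apply he
    (tendsto_limitProj_of_bound hlim (Eventually.of_forall fun t f => hb f t))
  have := norm_sub_limitProj_le_of_similar he hl (fun f => hb f t) f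
  rw [conditionNumber, hi]
  linarith

end Equilibrium

end ContractionSemigroup

open InnerProductSpace

/-! ### Polarization, weak limits and approximation of indicators. -/

section WeakLimit

variable {K : Type*} [NormedAddCommGroup K] [InnerProductSpace ℂ K]

theorem inner_map_polarization_right (T : K →L[ℂ] K) (x y : K) :
    inner ℂ x (T y) = (inner ℂ (x + y) (T (x + y)) - inner ℂ (x - y) (T (x - y))
      - Complex.I * inner ℂ (x + Complex.I • y) (T (x + Complex.I • y))
      + Complex.I * inner ℂ (x - Complex.I • y) (T (x - Complex.I • y))) / 4 := by
  simp only [map_add, map_sub, map_smul, inner_add_left, inner_add_right, inner_sub_left,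
    inner_sub_right, inner_smul_left, inner_smul_right, Complex.conj_I]
  linear_combination ((1 / 2 : ℂ) * inner ℂ x (T y) - (1 / 2 : ℂ) * inner ℂ y (T x)) * Complex.I_sq

theorem ContinuousLinearMap.ext_inner_self {S T : K →L[ℂ] K}
    (h : ∀ x, inner ℂ x (S x) = inner ℂ x (T x)) : S = T := by
  ext y
  refine ext_inner_left ℂ fun x => ?_
  rw [inner_map_polarization_right S, inner_map_polarization_right T]
  simp only [h]

theorem tendsto_inner_of_tendsto_inner_self {ι : Type*} {l : Filter ι} {T : ι → K →L[ℂ] K}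
    {S : K →L[ℂ] K}
    (h : ∀ x, Tendsto (fun n => inner ℂ x (T n x)) l (𝓝 (inner ℂ x (S x)))) (x y : K) :
    Tendsto (fun n => inner ℂ x (T n y)) l (𝓝 (inner ℂ x (S y))) := by
  simp only [inner_map_polarization_right _ x y]
  exact ((((h _).sub (h _)).sub ((h _).const_mul _)).add ((h _).const_mul _)).div_const _

/-- A bounded sequence of operators whose quadratic forms converge has a weak limit. -/
theorem exists_weak_limit [CompleteSpace K] {T : ℕ → K →L[ℂ] K} {q : K → ℂ} (hT : ∀ n, ‖T n‖ ≤ 1)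
    (h : ∀ x, Tendsto (fun n => inner ℂ x (T n x)) atTop (𝓝 (q x))) :
    ∃ S : K →L[ℂ] K, ∀ x, inner ℂ x (S x) = q x := by
  have hc : ∀ x y, ∃ c, Tendsto (fun n => inner ℂ (T n x) y) atTop (𝓝 c) := by
    intro x y
    have h1 : Tendsto (fun n => inner ℂ y (T n x)) atTop
        (𝓝 ((q (y + x) - q (y - x) - Complex.I * q (y + Complex.I • x)
          + Complex.I * q (y - Complex.I • x)) / 4)) := by
      simp only [inner_map_polarization_right _ y x]
      exact ((((h _).sub (h _)).sub ((h _).const_mul _)).add ((h _).const_mul _)).div_const _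
    refine ⟨_, ((Complex.continuous_conj.tendsto _).comp h1).congr fun n => ?_⟩
    simp
  choose B hB using hc
  -- The limit form is sesquilinear and bounded by `‖x‖ ‖y‖`, so Riesz representation turns it into
  -- an operator.
  let B' : K →ₗ⋆[ℂ] K →ₗ[ℂ] ℂ := LinearMap.mk₂'ₛₗ (starRingEnd ℂ) (RingHom.id ℂ) B
    (fun x₁ x₂ y => tendsto_nhds_unique (hB _ _)
      (by simpa [inner_add_left] using (hB x₁ y).add (hB x₂ y)))
    (fun c x y => tendsto_nhds_unique (hB _ _)
      (by simpa [inner_smul_left, mul_comm] using (hB x y).const_mul ((starRingEnd ℂ) c)))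
    (fun x y₁ y₂ => tendsto_nhds_unique (hB _ _)
      (by simpa [inner_add_right] using (hB x y₁).add (hB x y₂)))
    (fun c x y => tendsto_nhds_unique (hB _ _)
      (by simpa [inner_smul_right] using (hB x y).const_mul c))
  have hb : ∀ x y, ‖B' x y‖ ≤ 1 * ‖x‖ * ‖y‖ := by
    intro x y
    refine le_of_tendsto (hB x y).norm (Eventually.of_forall fun n => ?_)
    refine (norm_inner_le_norm _ _).trans ?_
    gcongr
    exact (T n).le_of_opNorm_le (hT n) x
  refine ⟨continuousLinearMapOfBilin (B'.mkContinuous₂ 1 hb), fun x => ?_⟩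
  rw [← inner_conj_symm, continuousLinearMapOfBilin_apply]
  refine tendsto_nhds_unique ((Complex.continuous_conj.tendsto _).comp (hB x x)) ?_
  exact (h x).congr fun n => by simp

/-- An operator whose quadratic form lies between `0` and `‖x‖²` is a contraction. -/
theorem norm_le_one_of_inner_self [CompleteSpace K] {T : K →L[ℂ] K} {q : K → ℝ}
    (h : ∀ x, inner ℂ x (T x) = (q x : ℂ)) (h0 : ∀ x, 0 ≤ q x) (h1 : ∀ x, q x ≤ ‖x‖ ^ 2) :
    ‖T‖ ≤ 1 := by
  have hT : ∀ x, inner ℂ (T x) x = (q x : ℂ) := fun x => by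
    rw [← inner_conj_symm, h, Complex.conj_ofReal]
  have hp : 0 ≤ T := by
    rw [ContinuousLinearMap.nonneg_iff_isPositive, ContinuousLinearMap.isPositive_iff_complex]
    exact fun x => by simp [hT, h0]
  rw [CStarAlgebra.norm_le_one_iff_of_nonneg T hp, ContinuousLinearMap.le_def,
    ContinuousLinearMap.isPositive_iff_complex]
  intro x
  have : inner ℂ ((1 - T) x) x = ((‖x‖ ^ 2 - q x : ℝ) : ℂ) := by
    simp [hT, inner_self_eq_norm_sq_to_K]
  rw [this]
  simp only [RCLike.re_to_complex, Complex.ofReal_re]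
  exact ⟨trivial, sub_nonneg.2 (h1 x)⟩

end WeakLimit

theorem exists_continuous_approx_of_isClosed {X : Type*} [TopologicalSpace X]
    [HasOuterApproxClosed X] {F : Set X} (hF : IsClosed F) :
    ∃ φ : ℕ → C(X, ℝ), (∀ n, 0 ≤ φ n) ∧ (∀ n x, φ n x ≤ 1) ∧
      ∀ x, Tendsto (fun n => φ n x) atTop (𝓝 (F.indicator 1 x)) := by
  refine ⟨fun n => ⟨fun x => (hF.apprSeq n x : ℝ), by fun_prop⟩, fun n x => NNReal.coe_nonneg _,
    fun n x => HasOuterApproxClosed.apprSeq_apply_le_one hF n x, fun x => ?_⟩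
  have := tendsto_pi_nhds.1 (HasOuterApproxClosed.tendsto_apprSeq hF) x
  have h2 := (NNReal.tendsto_coe.2 this)
  refine h2.congr' (Eventually.of_forall fun n => rfl) |>.trans (le_of_eq ?_)
  by_cases hx : x ∈ F <;> simp [hx]

theorem tendsto_setIntegral_of_tendsto_indicator {X : Type*} [TopologicalSpace X]
    [MeasurableSpace X] [BorelSpace X] (μ : Measure X) [IsFiniteMeasure μ] {F Ω : Set X}
    (hF : MeasurableSet F) {φ : ℕ → C(X, ℝ)} (h0 : ∀ n, 0 ≤ φ n) (h1 : ∀ n x, φ n x ≤ 1)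
    (h : ∀ x, Tendsto (fun n => φ n x) atTop (𝓝 (F.indicator 1 x))) :
    Tendsto (fun n => ∫ x in Ω, φ n x ∂μ) atTop (𝓝 (μ.real (F ∩ Ω))) := by
  have : μ.real (F ∩ Ω) = ∫ x in Ω, F.indicator 1 x ∂μ := by
    rw [integral_indicator_one hF, measureReal_restrict_apply hF]
  rw [this]
  refine tendsto_integral_of_dominated_convergence 1
    (fun n => (φ n).continuous.aestronglyMeasurable) (integrable_const 1) (fun n => ?_)
    (Eventually.of_forall h)
  refine Eventually.of_forall fun x => ?_
  exact (Real.norm_of_nonneg (h0 n x)).trans_le (h1 n x)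

theorem hasSum_measureReal_iUnion {X : Type*} [MeasurableSpace X] (μ : Measure X)
    [IsFiniteMeasure μ] {Ω : ℕ → Set X} (hΩ : ∀ i, MeasurableSet (Ω i))
    (hd : Pairwise (Function.onFun Disjoint Ω)) :
    HasSum (fun i => μ.real (Ω i)) (μ.real (⋃ i, Ω i)) := by
  simpa [hΩ, MeasurableSet.iUnion hΩ, Measure.toSignedMeasure_apply_measurable] using
    μ.toSignedMeasure.hasSum_of_disjoint_iUnion hΩ hd

/-! ### The projection-valued measure of a star homomorphism on `C(X, ℂ)`. -/

section SpectralMeasure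

variable {X : Type*} [TopologicalSpace X]
variable {K : Type*} [NormedAddCommGroup K] [InnerProductSpace ℂ K] [CompleteSpace K]

/-- A real continuous function as a complex one. -/
def ContinuousMap.complexOfReal (φ : C(X, ℝ)) : C(X, ℂ) :=
  (⟨Complex.ofReal, Complex.continuous_ofReal⟩ : C(ℝ, ℂ)).comp φ

@[simp]
theorem ContinuousMap.complexOfReal_apply (φ : C(X, ℝ)) (x : X) :
    φ.complexOfReal x = (φ x : ℂ) := rfl

variable (Φ : C(X, ℂ) →⋆ₐ[ℂ] (K →L[ℂ] K))

theorem inner_starAlgHom_star_mul (η : C(X, ℂ)) (f : K) :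
    inner ℂ f (Φ (star η * η) f) = ((‖Φ η f‖ ^ 2 : ℝ) : ℂ) := by
  rw [map_mul, map_star, ContinuousLinearMap.star_eq_adjoint, mul_apply_eq_comp,
    ContinuousLinearMap.adjoint_inner_right, inner_self_eq_norm_sq_to_K]
  norm_cast

theorem ContinuousMap.exists_complexOfReal_eq_star_mul_self {φ : C(X, ℝ)} (hφ : 0 ≤ φ) :
    ∃ η : C(X, ℝ), (∀ x, η x * η x = φ x) ∧
      φ.complexOfReal = star η.complexOfReal * η.complexOfReal := by
  refine ⟨⟨fun x => Real.sqrt (φ x), by fun_prop⟩, fun x => Real.mul_self_sqrt (hφ x), ?_⟩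
  ext x
  simp only [ContinuousMap.complexOfReal_apply, ContinuousMap.mul_apply,
    ContinuousMap.star_apply, RCLike.star_def, Complex.conj_ofReal, ← Complex.ofReal_mul]
  exact congrArg _ (Real.mul_self_sqrt (hφ x)).symm

theorem inner_starAlgHom_of_nonneg {φ : C(X, ℝ)} (hφ : 0 ≤ φ) (f : K) :
    0 ≤ (inner ℂ f (Φ φ.complexOfReal f)).re := by
  obtain ⟨η, -, hη⟩ := ContinuousMap.exists_complexOfReal_eq_star_mul_self hφ
  rw [hη, inner_starAlgHom_star_mul]
  rw [Complex.ofReal_re]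
  positivity

variable [CompactSpace X]

theorem ContinuousMap.integrable_of_compactSpace [MeasurableSpace X] [BorelSpace X]
    {E : Type*} [NormedAddCommGroup E] [SecondCountableTopologyEither X E]
    (μ : Measure X) [IsFiniteMeasure μ] (φ : C(X, E)) :
    Integrable φ μ :=
  φ.continuous.integrable_of_hasCompactSupport (HasCompactSupport.of_compactSpace φ)

open CompactlySupported in
/-- The positive functional `φ ↦ ⟨f, Φ(φ) f⟩`. -/
def spectralFunctional (f : K) : C_c(X, ℝ) →ₚ[ℝ] ℝ :=
  PositiveLinearMap.mk₀
    { toFun := fun φ => (inner ℂ f (Φ (φ : C(X, ℝ)).complexOfReal f)).re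
      map_add' := fun φ₁ φ₂ => by
        have : ((φ₁ + φ₂ : C_c(X, ℝ)) : C(X, ℝ)).complexOfReal =
            (φ₁ : C(X, ℝ)).complexOfReal + (φ₂ : C(X, ℝ)).complexOfReal := by
          ext x; simp
        rw [this, map_add, add_apply, inner_add_right, Complex.add_re]
      map_smul' := fun c φ => by
        have : ((c • φ : C_c(X, ℝ)) : C(X, ℝ)).complexOfReal =
            (c : ℂ) • (φ : C(X, ℝ)).complexOfReal := by
          ext x; simp
        rw [this, map_smul, smul_apply, inner_smul_right]
        simp }
    (fun φ hφ => inner_starAlgHom_of_nonneg Φ (φ := (φ : C(X, ℝ))) (fun x => hφ x) f)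

variable [T2Space X] [MeasurableSpace X] [BorelSpace X]

/-- The measure `μ_f` with `∫ φ dμ_f = ⟨f, Φ(φ) f⟩`. -/
def spectralMeasure (f : K) : Measure X := RealRMK.rieszMeasure (spectralFunctional Φ f)

instance (f : K) : IsFiniteMeasure (spectralMeasure Φ f) := by
  unfold spectralMeasure
  infer_instance

theorem integral_spectralMeasure_real (f : K) (φ : C(X, ℝ)) :
    ∫ x, φ x ∂(spectralMeasure Φ f) = (inner ℂ f (Φ φ.complexOfReal f)).re :=
  RealRMK.integral_rieszMeasure (spectralFunctional Φ f)
    (CompactlySupportedContinuousMap.continuousMapEquiv φ)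

theorem inner_starAlgHom_complexOfReal (f : K) (φ : C(X, ℝ)) :
    inner ℂ f (Φ φ.complexOfReal f) = ((∫ x, φ x ∂(spectralMeasure Φ f) : ℝ) : ℂ) := by
  rw [integral_spectralMeasure_real]
  refine Complex.ext (by simp) ?_
  rw [Complex.ofReal_im, ← Complex.conj_eq_iff_im, inner_conj_symm,
    ← ContinuousLinearMap.adjoint_inner_right, ← ContinuousLinearMap.star_eq_adjoint, ← map_star]
  congr 3
  ext x
  simp

theorem integral_spectralMeasure (f : K) (φ : C(X, ℂ)) :
    ∫ x, φ x ∂(spectralMeasure Φ f) = inner ℂ f (Φ φ f) := by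
  let φ₁ : C(X, ℝ) := ⟨fun x => (φ x).re, by fun_prop⟩
  let φ₂ : C(X, ℝ) := ⟨fun x => (φ x).im, by fun_prop⟩
  have h : φ = φ₁.complexOfReal + Complex.I • φ₂.complexOfReal := by
    ext x
    simp [φ₁, φ₂, mul_comm Complex.I, Complex.re_add_im]
  have h' : inner ℂ f (Φ φ f) = inner ℂ f (Φ φ₁.complexOfReal f) +
      Complex.I * inner ℂ f (Φ φ₂.complexOfReal f) := by
    rw [h]
    simp
  rw [h', inner_starAlgHom_complexOfReal, inner_starAlgHom_complexOfReal,
    ← integral_re_add_im (φ.integrable_of_compactSpace _)]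
  simp [φ₁, φ₂, mul_comm]

theorem spectralMeasure_real_univ (f : K) : (spectralMeasure Φ f).real Set.univ = ‖f‖ ^ 2 := by
  have := integral_spectralMeasure Φ f 1
  simp only [ContinuousMap.one_apply, integral_const, map_one, one_apply_eq_self,
    inner_self_eq_norm_sq_to_K] at this
  have h2 : (((spectralMeasure Φ f).real Set.univ : ℝ) : ℂ) = ((‖f‖ ^ 2 : ℝ) : ℂ) := by
    simpa using this
  exact_mod_cast h2

/-- `T` is the operator of the Borel set `Ω`: it has the quadratic form `μ_f(Ω)` and commutes
with the range of `Φ`. -/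
structure IsSpectralProj (Ω : Set X) (T : K →L[ℂ] K) : Prop where
  inner_self : ∀ f, inner ℂ f (T f) = ((spectralMeasure Φ f).real Ω : ℂ)
  commute : ∀ φ, Commute T (Φ φ)

variable {Φ}

theorem IsSpectralProj.norm_le_one {Ω : Set X} {T : K →L[ℂ] K} (h : IsSpectralProj Φ Ω T) :
    ‖T‖ ≤ 1 :=
  norm_le_one_of_inner_self h.inner_self (fun _ => measureReal_nonneg) fun f => by
    rw [← spectralMeasure_real_univ Φ f]
    exact measureReal_mono (Set.subset_univ _)

theorem IsSpectralProj.eq {Ω : Set X} {S T : K →L[ℂ] K} (hS : IsSpectralProj Φ Ω S)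
    (hT : IsSpectralProj Φ Ω T) : S = T :=
  ContinuousLinearMap.ext_inner_self fun x => by rw [hS.inner_self, hT.inner_self]

theorem IsSpectralProj.inner_left {Ω : Set X} {T : K →L[ℂ] K} (h : IsSpectralProj Φ Ω T) (x y : K) :
    inner ℂ (T x) y = inner ℂ x (T y) := by
  have : T.adjoint = T := ContinuousLinearMap.ext_inner_self fun x => by
    rw [ContinuousLinearMap.adjoint_inner_right, ← inner_conj_symm, h.inner_self,
      Complex.conj_ofReal]
  rw [← ContinuousLinearMap.adjoint_inner_right, this]

theorem isSpectralProj_univ : IsSpectralProj Φ Set.univ 1 :=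
  ⟨fun f => by
    rw [spectralMeasure_real_univ, one_apply_eq_self, inner_self_eq_norm_sq_to_K]
    norm_cast, fun φ => Commute.one_left _⟩

theorem isSpectralProj_empty : IsSpectralProj Φ (∅ : Set X) 0 :=
  ⟨fun f => by simp, fun φ => Commute.zero_left _⟩

theorem IsSpectralProj.compl {Ω : Set X} {T : K →L[ℂ] K} (h : IsSpectralProj Φ Ω T)
    (hΩ : MeasurableSet Ω) : IsSpectralProj Φ Ωᶜ (1 - T) := by
  refine ⟨fun f => ?_, fun φ => (Commute.one_left _).sub_left (h.commute φ)⟩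
  rw [sub_apply, inner_sub_right, h.inner_self, (isSpectralProj_univ (Φ := Φ)).inner_self,
    measureReal_compl hΩ]
  push_cast
  rfl

theorem isSpectralProj_finset_sum {ι : Type*} (s : Finset ι) {Ω : ι → Set X} {T : ι → K →L[ℂ] K}
    (h : ∀ i, IsSpectralProj Φ (Ω i) (T i)) (hΩ : ∀ i, MeasurableSet (Ω i))
    (hd : Pairwise (Function.onFun Disjoint Ω)) :
    IsSpectralProj Φ (⋃ i ∈ s, Ω i) (∑ i ∈ s, T i) := by
  refine ⟨fun f => ?_, fun φ => Commute.sum_left _ _ _ fun i _ => (h i).commute φ⟩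
  rw [measureReal_biUnion_finset (fun i _ j _ hij => hd hij) fun i _ => hΩ i]
  simp [(h _).inner_self]

/-- Commutation survives weak limits: `Φ φ` can be moved to the other side of the inner product as
its adjoint, leaving a weak limit of `T n` alone in each term. -/
theorem IsSpectralProj.of_tendsto {T : ℕ → K →L[ℂ] K} {Ω : Set X} (hT : ∀ n, ‖T n‖ ≤ 1)
    (hc : ∀ n φ, Commute (T n) (Φ φ))
    (h : ∀ f, Tendsto (fun n => inner ℂ f (T n f)) atTop
      (𝓝 ((spectralMeasure Φ f).real Ω : ℂ))) :
    ∃ S, IsSpectralProj Φ Ω S := by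
  obtain ⟨S, hS⟩ := exists_weak_limit hT h
  refine ⟨S, hS, fun φ => ?_⟩
  have hw := tendsto_inner_of_tendsto_inner_self (T := T) (S := S) (l := atTop)
    (fun x => by rw [hS]; exact h x)
  ext y
  refine ext_inner_left ℂ fun x => ?_
  rw [mul_apply_eq_comp, mul_apply_eq_comp, ← ContinuousLinearMap.adjoint_inner_left (Φ φ)]
  refine tendsto_nhds_unique (hw _ _) ((hw _ _).congr fun n => ?_)
  rw [ContinuousLinearMap.adjoint_inner_left, ← mul_apply_eq_comp, ← mul_apply_eq_comp,
    (hc n φ).eq]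

variable (Φ) in
theorem norm_starAlgHom_complexOfReal_le {φ : C(X, ℝ)} (h0 : 0 ≤ φ) (h1 : ∀ x, φ x ≤ 1) :
    ‖Φ φ.complexOfReal‖ ≤ 1 := by
  refine norm_le_one_of_inner_self (inner_starAlgHom_complexOfReal Φ · φ)
    (fun x => integral_nonneg h0) fun f => ?_
  rw [← spectralMeasure_real_univ Φ f]
  calc _ ≤ ∫ x, (1 : ℝ) ∂(spectralMeasure Φ f) :=
        integral_mono (φ.integrable_of_compactSpace _) (integrable_const 1) h1
    _ = _ := by simp

variable [HasOuterApproxClosed X]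

variable (Φ) in
/-- `μ_{Φ(η) f} = |η|² μ_f`. -/
theorem spectralMeasure_starAlgHom_apply (η : C(X, ℂ)) (f : K) :
    spectralMeasure Φ (Φ η f) =
      (spectralMeasure Φ f).withDensity fun x => ((‖η x‖₊ ^ 2 : ℝ≥0) : ENNReal) := by
  have hm : Measurable fun x => (‖η x‖₊ ^ 2 : ℝ≥0) := by
    have : Continuous fun x => (‖η x‖₊ ^ 2 : ℝ≥0) := by fun_prop
    exact this.measurable
  have : IsFiniteMeasure
      ((spectralMeasure Φ f).withDensity fun x => ((‖η x‖₊ ^ 2 : ℝ≥0) : ENNReal)) := by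
    refine isFiniteMeasure_withDensity
      (IsFiniteMeasure.lintegral_lt_top_of_bounded_to_ennreal _ ⟨‖η‖₊ ^ 2, fun x => ?_⟩).ne
    have : ‖η x‖₊ ≤ ‖η‖₊ := η.norm_coe_le_norm x
    gcongr
  refine ext_of_forall_integral_eq_of_IsFiniteMeasure fun φ => ?_
  rw [integral_withDensity_eq_integral_smul hm]
  have h1 := inner_starAlgHom_complexOfReal Φ (Φ η f) φ.toContinuousMap
  let ζ : C(X, ℝ) := ⟨fun x => ‖η x‖ ^ 2 * φ x, by fun_prop⟩
  have h2 := inner_starAlgHom_complexOfReal Φ f ζ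
  -- Both measures are tested on `φ`, using `Φ(|η|² φ) = Φ(η)* Φ(φ) Φ(η)`.
  have h3 : ζ.complexOfReal = star η * φ.toContinuousMap.complexOfReal * η := by
    ext x
    have := Complex.conj_mul' (η x)
    simp [ζ]
    rw [← this]
    ring
  rw [h3, map_mul, map_mul, mul_apply_eq_comp, mul_apply_eq_comp, map_star,
    ContinuousLinearMap.star_eq_adjoint, ContinuousLinearMap.adjoint_inner_right, h1] at h2
  have h4 := Complex.ofReal_injective h2
  simpa [ζ, NNReal.smul_def] using h4

variable (Φ) in
-- Closed sets generate the Borel sets, and their indicators are bounded limits of continuous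
-- functions; complements come from `1 - T` and disjoint unions from weak limits of partial sums.
theorem exists_isSpectralProj {Ω : Set X} (hΩ : MeasurableSet Ω) : ∃ T, IsSpectralProj Φ Ω T := by
  induction Ω, hΩ using MeasurableSpace.induction_on_inter
    ((BorelSpace.measurable_eq (α := X)).trans borel_eq_generateFrom_isClosed)
    isPiSystem_isClosed with
  | empty => exact ⟨0, isSpectralProj_empty⟩
  | basic F hF =>
    obtain ⟨φ, h0, h1, hlim⟩ := exists_continuous_approx_of_isClosed hF
    refine IsSpectralProj.of_tendsto (T := fun n => Φ (φ n).complexOfReal)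
      (fun n => norm_starAlgHom_complexOfReal_le Φ (h0 n) (h1 n))
      (fun n ψ => (Commute.all _ _).map Φ) fun f => ?_
    simp only [inner_starAlgHom_complexOfReal]
    refine (Complex.continuous_ofReal.tendsto _).comp ?_
    simpa using tendsto_setIntegral_of_tendsto_indicator (spectralMeasure Φ f) (Ω := Set.univ)
      (IsClosed.measurableSet hF) h0 h1 hlim
  | compl Ω hΩ ih => exact ih.elim fun T hT => ⟨_, hT.compl hΩ⟩
  | iUnion Ω hd hΩ ih =>
    choose T hT using ih
    have hsum := fun s : Finset ℕ => isSpectralProj_finset_sum s hT hΩ hd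
    refine IsSpectralProj.of_tendsto (T := fun n => ∑ i ∈ Finset.range n, T i)
      (fun n => (hsum _).norm_le_one) (fun n => (hsum _).commute) fun f => ?_
    simp only [sum_apply, inner_sum, (hT _).inner_self]
    exact (Complex.hasSum_ofReal.2 (hasSum_measureReal_iUnion _ hΩ hd)).tendsto_sum_nat

/-- With `φ = η²`, the operator `T` commutes with `Φ(η)`, so the left side is `⟨Φ(η) f, T Φ(η) f⟩ =
μ_{Φ(η) f}(Ω)`, and `μ_{Φ(η) f} = |η|² μ_f`. -/
theorem IsSpectralProj.inner_starAlgHom {Ω : Set X} {T : K →L[ℂ] K} (h : IsSpectralProj Φ Ω T)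
    (hΩ : MeasurableSet Ω) {φ : C(X, ℝ)} (hφ : 0 ≤ φ) (f : K) :
    inner ℂ f (Φ φ.complexOfReal (T f)) = ((∫ x in Ω, φ x ∂(spectralMeasure Φ f) : ℝ) : ℂ) := by
  obtain ⟨η, hsq, hη⟩ := ContinuousMap.exists_complexOfReal_eq_star_mul_self hφ
  have hc := h.commute η.complexOfReal
  rw [hη, map_mul, map_star, ContinuousLinearMap.star_eq_adjoint, mul_apply_eq_comp,
    ContinuousLinearMap.adjoint_inner_right, ← mul_apply_eq_comp, ← hc.eq, mul_apply_eq_comp,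
    h.inner_self, spectralMeasure_starAlgHom_apply]
  congr 1
  rw [measureReal_def, withDensity_apply _ hΩ, integral_eq_lintegral_of_nonneg_ae]
  · congr 1
    refine lintegral_congr fun x => ?_
    rw [← hsq x, ENNReal.ofReal, ENNReal.coe_inj]
    refine NNReal.eq ?_
    rw [Real.coe_toNNReal _ (mul_self_nonneg _)]
    simp [sq]
  · exact Eventually.of_forall hφ
  · exact φ.continuous.aestronglyMeasurable

/-- Idempotence and multiplicativity are not built into `IsSpectralProj`. A weak limit may be taken
in one factor at a time, hence the induction on `Ω₁` with the vector `T₂ f` fixed. -/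
theorem IsSpectralProj.inner_mul {Ω₁ Ω₂ : Set X} {T₁ T₂ : K →L[ℂ] K}
    (h₁ : IsSpectralProj Φ Ω₁ T₁) (h₂ : IsSpectralProj Φ Ω₂ T₂) (hΩ₁ : MeasurableSet Ω₁)
    (hΩ₂ : MeasurableSet Ω₂) (f : K) :
    inner ℂ f (T₁ (T₂ f)) = ((spectralMeasure Φ f).real (Ω₁ ∩ Ω₂) : ℂ) := by
  induction Ω₁, hΩ₁ using MeasurableSpace.induction_on_inter
    ((BorelSpace.measurable_eq (α := X)).trans borel_eq_generateFrom_isClosed)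
    isPiSystem_isClosed generalizing T₁ with
  | empty => simp [h₁.eq isSpectralProj_empty]
  | basic F hF =>
    have hFm : MeasurableSet F := IsClosed.measurableSet hF
    obtain ⟨φ, h0, h1, hlim⟩ := exists_continuous_approx_of_isClosed hF
    have hw := tendsto_inner_of_tendsto_inner_self (T := fun n => Φ (φ n).complexOfReal) (S := T₁)
      (l := atTop) fun x => by
        simp only [inner_starAlgHom_complexOfReal, h₁.inner_self]
        refine (Complex.continuous_ofReal.tendsto _).comp ?_
        simpa using tendsto_setIntegral_of_tendsto_indicator (spectralMeasure Φ x) (Ω := Set.univ)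
          hFm h0 h1 hlim
    refine tendsto_nhds_unique (hw f (T₂ f)) ?_
    simp only [h₂.inner_starAlgHom hΩ₂ (h0 _)]
    exact (Complex.continuous_ofReal.tendsto _).comp
      (tendsto_setIntegral_of_tendsto_indicator _ hFm h0 h1 hlim)
  | compl Ω hΩ ih =>
    have h := ih (T₁ := 1 - T₁) (by simpa using h₁.compl hΩ.compl)
    rw [sub_apply, inner_sub_right, one_apply_eq_self, h₂.inner_self, sub_eq_iff_eq_add] at h
    have h3 := measureReal_inter_add_sdiff (μ := spectralMeasure Φ f) (s := Ω₂) hΩ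
    rw [Set.inter_comm, ← Set.sdiff_eq, ← sub_eq_iff_eq_add'.2 h3.symm, eq_comm, Complex.ofReal_sub,
      h, Set.inter_comm Ω]
    ring
  | iUnion Ω hd hΩ ih =>
    choose T hT using fun i => exists_isSpectralProj Φ (hΩ i)
    have hw := tendsto_inner_of_tendsto_inner_self (T := fun n => ∑ i ∈ Finset.range n, T i)
      (S := T₁) (l := atTop) fun x => by
        simp only [sum_apply, inner_sum, (hT _).inner_self, h₁.inner_self]
        exact (Complex.hasSum_ofReal.2 (hasSum_measureReal_iUnion _ hΩ hd)).tendsto_sum_nat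
    refine tendsto_nhds_unique (hw f (T₂ f)) ?_
    simp only [sum_apply, inner_sum, ih _ (hT _), Set.iUnion_inter]
    exact (Complex.hasSum_ofReal.2 (hasSum_measureReal_iUnion _ (fun i => (hΩ i).inter hΩ₂)
      fun i j hij => (hd hij).mono Set.inter_subset_left Set.inter_subset_left)).tendsto_sum_nat

theorem IsSpectralProj.mul {Ω₁ Ω₂ : Set X} {T₁ T₂ : K →L[ℂ] K}
    (h₁ : IsSpectralProj Φ Ω₁ T₁) (h₂ : IsSpectralProj Φ Ω₂ T₂) (hΩ₁ : MeasurableSet Ω₁)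
    (hΩ₂ : MeasurableSet Ω₂) : IsSpectralProj Φ (Ω₁ ∩ Ω₂) (T₁ * T₂) :=
  ⟨h₁.inner_mul h₂ hΩ₁ hΩ₂, fun φ => (h₁.commute φ).mul_left (h₂.commute φ)⟩

theorem IsSpectralProj.norm_sq {Ω : Set X} {T : K →L[ℂ] K} (h : IsSpectralProj Φ Ω T)
    (hΩ : MeasurableSet Ω) (f : K) : ‖T f‖ ^ 2 = (spectralMeasure Φ f).real Ω := by
  have h1 := h.inner_mul h hΩ hΩ f
  rw [← h.inner_left, inner_self_eq_norm_sq_to_K, Set.inter_self] at h1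
  refine Complex.ofReal_injective ?_
  rw [← h1]
  norm_cast

variable (Φ) in
open Classical in
/-- The projection-valued measure of `Φ`. -/
def spectralProj (Ω : Set X) : K →L[ℂ] K :=
  if h : MeasurableSet Ω then (exists_isSpectralProj Φ h).choose else 0

variable (Φ) in
theorem isSpectralProj_spectralProj {Ω : Set X} (hΩ : MeasurableSet Ω) :
    IsSpectralProj Φ Ω (spectralProj Φ Ω) := by
  rw [spectralProj, dif_pos hΩ]
  exact (exists_isSpectralProj Φ hΩ).choose_spec

variable (Φ) in
-- Strong convergence follows because the error after finitely many terms is itself a spectral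
-- projection applied to `f`: its squared norm is the `μ_f`-mass of the remaining union.
theorem hasSum_spectralProj {Ω : ℕ → Set X} (hΩ : ∀ i, MeasurableSet (Ω i))
    (hd : Pairwise (Function.onFun Disjoint Ω)) (f : K) :
    HasSum (fun i => spectralProj Φ (Ω i) f) (spectralProj Φ (⋃ i, Ω i) f) := by
  have hU := isSpectralProj_spectralProj Φ (MeasurableSet.iUnion hΩ)
  have hs := fun s : Finset ℕ =>
    isSpectralProj_finset_sum s (fun i => isSpectralProj_spectralProj Φ (hΩ i)) hΩ hd
  have hm := fun s : Finset ℕ => Finset.measurableSet_biUnion s fun i _ => hΩ i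
  have hle := fun s : Finset ℕ => Set.iUnion₂_subset fun i (_ : i ∈ s) => Set.subset_iUnion Ω i
  have key : ∀ s : Finset ℕ, ‖∑ i ∈ s, spectralProj Φ (Ω i) f - spectralProj Φ (⋃ i, Ω i) f‖ ^ 2 =
      (spectralMeasure Φ f).real (⋃ i, Ω i) - ∑ i ∈ s, (spectralMeasure Φ f).real (Ω i) := by
    intro s
    have h1 := hU.mul ((hs s).compl (hm s)) (MeasurableSet.iUnion hΩ) (hm s).compl
    have h2 := hU.mul (hs s) (MeasurableSet.iUnion hΩ) (hm s)
    rw [Set.inter_eq_right.2 (hle s)] at h2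
    have h3 := h1.norm_sq ((MeasurableSet.iUnion hΩ).inter (hm s).compl) f
    rw [mul_sub, h2.eq (hs s), mul_one, ← Set.sdiff_eq, measureReal_sdiff (hle s) (hm s),
      measureReal_biUnion_finset (fun i _ j _ hij => hd hij) fun i _ => hΩ i] at h3
    rw [← h3, norm_sub_rev]
    simp
  rw [HasSum, tendsto_iff_norm_sub_tendsto_zero]
  have h4 : Tendsto (fun s : Finset ℕ =>
      ‖∑ i ∈ s, spectralProj Φ (Ω i) f - spectralProj Φ (⋃ i, Ω i) f‖ ^ 2) atTop (𝓝 0) := by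
    simp only [key]
    simpa using (hasSum_measureReal_iUnion (spectralMeasure Φ f) hΩ hd).const_sub
      ((spectralMeasure Φ f).real (⋃ i, Ω i))
  simpa using h4.sqrt

end SpectralMeasure

namespace ContractionSemigroup

/-! ### The generator and the resolvent `(1 + A)⁻¹`. -/

section Resolvent

variable {H : Type*} [NormedAddCommGroup H] [InnerProductSpace ℂ H]

theorem norm_op_sub_op_le (P : ContractionSemigroup ℂ H) (f : H) (s t : ℝ≥0) :
    ‖P.op s f - P.op t f‖ ≤ ‖P.op (nndist s t) f - f‖ := by
  wlog hst : s ≤ t generalizing s t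
  · rw [norm_sub_rev, nndist_comm]
    exact this t s (le_of_not_ge hst)
  obtain ⟨u, rfl⟩ := exists_add_of_le hst
  have hu : nndist s (s + u) = u := by
    refine NNReal.eq ?_
    rw [coe_nndist, NNReal.dist_eq]
    simp
  rw [hu, norm_sub_rev, P.op_add, ContinuousLinearMap.comp_apply, ← map_sub]
  exact P.norm_op_apply_le s _

theorem continuous_op_apply (P : ContractionSemigroup ℂ H) (f : H) :
    Continuous fun t => P.op t f := by
  rw [continuous_iff_continuousAt]
  intro t
  rw [ContinuousAt, tendsto_iff_norm_sub_tendsto_zero]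
  refine squeeze_zero (fun _ => norm_nonneg _) (fun s => P.norm_op_sub_op_le f s t) ?_
  refine (P.tendsto_zero f).comp ?_
  have : Continuous fun s : ℝ≥0 => nndist s t := by fun_prop
  simpa using this.tendsto t

theorem diffQuot_eq (P : ContractionSemigroup ℂ H) (f : H) (t : ℝ≥0) :
    P.diffQuot f t = (t : ℝ)⁻¹ • (P.op t f - f) := by
  rw [diffQuot, ← RCLike.ofReal_inv, ← RCLike.real_smul_eq_coe_smul]

/-- Right differentiability at `0` of an orbit is convergence of its difference quotients. -/
theorem tendsto_diffQuot_iff (P : ContractionSemigroup ℂ H) {f g : H} :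
    Tendsto (P.diffQuot f) (𝓝[>] 0) (𝓝 g) ↔
      HasDerivWithinAt (fun t : ℝ => P.op t.toNNReal f) g (Set.Ioi 0) 0 := by
  rw [hasDerivWithinAt_iff_tendsto_slope' (by simp)]
  have hmap : map ((↑) : ℝ≥0 → ℝ) (𝓝[>] 0) = 𝓝[>] 0 := by
    have := (NNReal.isEmbedding_coe).map_nhdsWithin_eq (Set.Ioi (0 : ℝ≥0)) 0
    rw [this]
    congr 1
    ext x
    constructor
    · rintro ⟨y, hy, rfl⟩
      exact hy
    · intro hx
      exact ⟨⟨x, le_of_lt hx⟩, hx, rfl⟩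
  rw [← hmap, tendsto_map'_iff]
  refine tendsto_congr fun t => ?_
  simp [diffQuot_eq, slope_def_module, P.op_zero]

theorem mem_graph_operatorA_iff (P : ContractionSemigroup ℂ H) {f g : H} :
    (f, g) ∈ P.operatorA.graph ↔ Tendsto (P.diffQuot f) (𝓝[>] 0) (𝓝 (-g)) := by
  have key : ∀ x : P.generatorDomain,
      Tendsto (P.diffQuot x) (𝓝[>] 0) (𝓝 (P.generator x)) := fun x => Classical.choose_spec x.2
  rw [LinearPMap.mem_graph_iff]
  constructor
  · rintro ⟨y, rfl, hy⟩
    have : P.generator y = -g := by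
      rw [← show P.operatorA y = g from hy]
      exact (neg_neg (P.generator y)).symm
    rw [← this]
    exact key y
  · intro h
    refine ⟨⟨f, -g, h⟩, rfl, ?_⟩
    have h2 := tendsto_nhds_unique (key ⟨f, -g, h⟩) h
    exact neg_eq_iff_eq_neg.2 h2

/-- Contractivity gives `Re ⟨f, P_t f⟩ ≤ ‖f‖²`; divide by `t` and let `t ↓ 0`. -/
theorem re_inner_operatorA_nonneg (P : ContractionSemigroup ℂ H) {f g : H}
    (h : (f, g) ∈ P.operatorA.graph) : 0 ≤ (inner ℂ f g).re := by
  rw [mem_graph_operatorA_iff] at h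
  have h1 : Tendsto (fun t => (inner ℂ f (P.diffQuot f t)).re) (𝓝[>] 0)
      (𝓝 (inner ℂ f (-g)).re) :=
    (Complex.continuous_re.tendsto _).comp (tendsto_const_nhds.inner h)
  have h2 : (inner ℂ f (-g)).re ≤ 0 := by
    refine le_of_tendsto h1 (Eventually.of_forall fun t => ?_)
    have h3 : (inner ℂ f (P.op t f)).re ≤ ‖f‖ * ‖f‖ :=
      (Complex.re_le_norm _).trans ((norm_inner_le_norm _ _).trans
        (mul_le_mul_of_nonneg_left (P.norm_op_apply_le t f) (norm_nonneg _)))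
    rw [diffQuot_eq, inner_smul_right_eq_smul, Complex.smul_re, inner_sub_right, Complex.sub_re,
      smul_eq_mul]
    have h4 : (inner ℂ f f).re = ‖f‖ * ‖f‖ := by
      rw [← sq]
      exact inner_self_eq_norm_sq (𝕜 := ℂ) f
    refine mul_nonpos_of_nonneg_of_nonpos (by positivity) (by linarith)
  rw [inner_neg_right, Complex.neg_re] at h2
  linarith

/-- The weighted orbit `e^{-t} P_t f`. -/
def dampedOrbit (P : ContractionSemigroup ℂ H) (f : H) (t : ℝ) : H :=
  Real.exp (-t) • P.op t.toNNReal f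

theorem continuous_dampedOrbit (P : ContractionSemigroup ℂ H) (f : H) :
    Continuous (P.dampedOrbit f) :=
  (by fun_prop : Continuous fun t : ℝ => Real.exp (-t)).smul
    ((P.continuous_op_apply f).comp continuous_real_toNNReal)

theorem norm_dampedOrbit_le (P : ContractionSemigroup ℂ H) (f : H) (t : ℝ) :
    ‖P.dampedOrbit f t‖ ≤ Real.exp (-t) * ‖f‖ := by
  rw [dampedOrbit, norm_smul, Real.norm_of_nonneg (Real.exp_pos _).le]
  gcongr
  exact P.norm_op_apply_le _ f

theorem integrableOn_dampedOrbit (P : ContractionSemigroup ℂ H) (f : H) (a : ℝ) :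
    IntegrableOn (P.dampedOrbit f) (Set.Ioi a) :=
  ((integrableOn_exp_neg_Ioi a).mul_const ‖f‖).mono'
    (P.continuous_dampedOrbit f).aestronglyMeasurable
    (Eventually.of_forall (P.norm_dampedOrbit_le f))

/-- The resolvent `(1 + A)⁻¹ = ∫₀^∞ e^{-t} P_t dt`. -/
def resolvent (P : ContractionSemigroup ℂ H) : H →L[ℂ] H :=
  LinearMap.mkContinuous
    { toFun := fun f => ∫ t in Set.Ioi 0, P.dampedOrbit f t
      map_add' := fun f g => by
        rw [← integral_add (P.integrableOn_dampedOrbit f 0) (P.integrableOn_dampedOrbit g 0)]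
        simp [dampedOrbit]
      map_smul' := fun c f => by
        rw [RingHom.id_apply, ← integral_smul]
        simp only [dampedOrbit, map_smul]
        simp_rw [smul_comm c] } 1 (fun f => by
      refine (norm_integral_le_of_norm_le ((integrableOn_exp_neg_Ioi 0).mul_const ‖f‖)
        (Eventually.of_forall (P.norm_dampedOrbit_le f))).trans ?_
      rw [integral_mul_const, integral_exp_neg_Ioi_zero])

theorem resolvent_apply (P : ContractionSemigroup ℂ H) (f : H) :
    P.resolvent f = ∫ t in Set.Ioi 0, P.dampedOrbit f t := rfl

variable [CompleteSpace H]

/-- Translating the integral by `h` gives `e^h ∫_h^∞`. Writing this through `∫_0^h` makes the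
derivative at `h = 0` immediate. -/
theorem op_resolvent (P : ContractionSemigroup ℂ H) (f : H) {h : ℝ} (hh : 0 ≤ h) :
    P.op h.toNNReal (P.resolvent f) =
      Real.exp h • (P.resolvent f - ∫ t in (0 : ℝ)..h, P.dampedOrbit f t) := by
  have h1 : P.resolvent f - ∫ t in (0 : ℝ)..h, P.dampedOrbit f t =
      ∫ t in Set.Ioi h, P.dampedOrbit f t := by
    rw [resolvent_apply, ← intervalIntegral.integral_interval_add_Ioi
      (P.integrableOn_dampedOrbit f 0) (P.integrableOn_dampedOrbit f h), add_sub_cancel_left]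
  have h2 := (measurePreserving_add_right (volume : Measure ℝ) h).setIntegral_preimage_emb
    (measurableEmbedding_addRight h) (P.dampedOrbit f) (Set.Ioi h)
  rw [h1, ← h2, resolvent_apply, ← ContinuousLinearMap.integral_comp_comm _
    (P.integrableOn_dampedOrbit f 0), ← integral_smul]
  simp only [Set.preimage_add_const_Ioi, sub_self]
  refine setIntegral_congr_fun measurableSet_Ioi fun t ht => ?_
  have ht' : 0 ≤ t := le_of_lt ht
  simp only [dampedOrbit]
  rw [smul_smul, ← Real.exp_add, Real.toNNReal_add ht' hh, add_comm t.toNNReal, P.op_add]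
  simp

theorem mem_graph_resolvent (P : ContractionSemigroup ℂ H) (f : H) :
    (P.resolvent f, f - P.resolvent f) ∈ P.operatorA.graph := by
  rw [mem_graph_operatorA_iff, tendsto_diffQuot_iff]
  have hc := P.continuous_dampedOrbit f
  have h1 : HasDerivAt (fun h => ∫ t in (0 : ℝ)..h, P.dampedOrbit f t) f 0 := by
    have := intervalIntegral.integral_hasDerivAt_right (hc.intervalIntegrable 0 0)
      hc.stronglyMeasurable.stronglyMeasurableAtFilter hc.continuousAt
    simpa [dampedOrbit, P.op_zero] using this
  have h2 := (Real.hasDerivAt_exp 0).smul (h1.const_sub (P.resolvent f))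
  have h3 : HasDerivAt (fun h => Real.exp h •
      (P.resolvent f - ∫ t in (0 : ℝ)..h, P.dampedOrbit f t)) (-(f - P.resolvent f)) 0 := by
    refine h2.congr_deriv ?_
    simp
    abel
  refine h3.hasDerivWithinAt.congr (fun h hh => P.op_resolvent f (le_of_lt hh))
    (P.op_resolvent f le_rfl)

/-- The difference `d = x - R (x + y)` satisfies `A d = -d`, so accretivity gives `0 ≤ -‖d‖²`. All
later work with `A`, `A*` and `σ(A)` goes through this description of the graph. -/
theorem mem_graph_operatorA_iff_resolvent (P : ContractionSemigroup ℂ H) {x y : H} :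
    (x, y) ∈ P.operatorA.graph ↔ x = P.resolvent (x + y) := by
  constructor
  · intro h
    have h1 := P.operatorA.graph.sub_mem h (P.mem_graph_resolvent (x + y))
    have h2 := P.re_inner_operatorA_nonneg h1
    set d := x - P.resolvent (x + y) with hd
    have h3 : y - (x + y - P.resolvent (x + y)) = -d := by rw [hd]; abel
    change 0 ≤ (inner ℂ d (y - (x + y - P.resolvent (x + y)))).re at h2
    rw [h3, inner_neg_right, Complex.neg_re] at h2
    have h4 : (inner ℂ d d).re = ‖d‖ ^ 2 := inner_self_eq_norm_sq (𝕜 := ℂ) d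
    have h5 : ‖d‖ = 0 := by nlinarith [norm_nonneg d]
    exact sub_eq_zero.1 (norm_eq_zero.1 h5)
  · intro h
    have := P.mem_graph_resolvent (x + y)
    rwa [← h, add_sub_cancel_left] at this

theorem resolvent_injective (P : ContractionSemigroup ℂ H) : Function.Injective P.resolvent := by
  rw [injective_iff_map_eq_zero]
  intro x hx
  have := P.mem_graph_resolvent x
  rw [hx, sub_zero] at this
  exact P.operatorA.graph_fst_eq_zero_snd this rfl

theorem commute_op_resolvent (P : ContractionSemigroup ℂ H) (t : ℝ≥0) :
    Commute (P.op t) P.resolvent := by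
  ext f
  rw [mul_apply_eq_comp, mul_apply_eq_comp, resolvent_apply, resolvent_apply,
    ← ContinuousLinearMap.integral_comp_comm _ (P.integrableOn_dampedOrbit f 0)]
  refine integral_congr_ae (Eventually.of_forall fun s => ?_)
  simp only [dampedOrbit]
  rw [ContinuousLinearMap.map_smul_of_tower, ← ContinuousLinearMap.comp_apply,
    ← ContinuousLinearMap.comp_apply, ← P.op_add, ← P.op_add, add_comm]

/-- `2(1 + A)⁻¹ - 1` is a contraction. -/
theorem norm_two_smul_resolvent_sub_one_le (P : ContractionSemigroup ℂ H) :
    ‖(2 : ℂ) • P.resolvent - 1‖ ≤ 1 := by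
  refine ContinuousLinearMap.opNorm_le_bound _ zero_le_one fun x => ?_
  have h := P.re_inner_operatorA_nonneg (P.mem_graph_resolvent x)
  have h1 : ((2 : ℂ) • P.resolvent - 1) x = P.resolvent x - (x - P.resolvent x) := by
    simp [two_smul]
    abel
  have h2 : x = P.resolvent x + (x - P.resolvent x) := by abel
  rw [h1, one_mul]
  conv_rhs => rw [h2]
  -- With `u = R x`, the claim is `‖u - A u‖ ≤ ‖u + A u‖`, that is, `0 ≤ Re ⟨u, A u⟩`.
  refine le_of_sq_le_sq ?_ (norm_nonneg _)
  rw [@norm_sub_sq ℂ, @norm_add_sq ℂ]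
  simp only [RCLike.re_to_complex]
  linarith

theorem resolvent_apply_equiv {K : Type*} [NormedAddCommGroup K] [InnerProductSpace ℂ K]
    [CompleteSpace K] {P : ContractionSemigroup ℂ H} {Q : ContractionSemigroup ℂ K}
    {e : K ≃L[ℂ] H} (he : ∀ t f, P.op t (e f) = e (Q.op t f)) (f : K) :
    P.resolvent (e f) = e (Q.resolvent f) := by
  rw [resolvent_apply, resolvent_apply]
  refine Eq.trans ?_ (ContinuousLinearMap.integral_comp_comm (e : K →L[ℂ] H)
    (Q.integrableOn_dampedOrbit f 0))
  refine integral_congr_ae (Eventually.of_forall fun s => ?_)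
  simp [dampedOrbit, he]

end Resolvent

end ContractionSemigroup

/-! ### The spectrum of `A` in terms of that of `R`. -/

section ResolventSpectrum

variable {H : Type*} [NormedAddCommGroup H] [InnerProductSpace ℂ H]

/-- If `R = (1 + A)⁻¹`, then `z ∈ σ(A)` if and only if `z ≠ -1` and `(z + 1)⁻¹ ∈ σ(R)`. -/
theorem operatorSpectrum_eq_of_resolvent {A : H →ₗ.[ℂ] H} {R : H →L[ℂ] H}
    (hR : ∀ x y, (x, y) ∈ A.graph ↔ x = R (x + y)) :
    operatorSpectrum A = {z | z ≠ -1 ∧ (z + 1)⁻¹ ∈ spectrum ℂ R} := by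
  have hgraph : ∀ v, (R v, v - R v) ∈ A.graph := fun v => by
    rw [hR, add_sub_cancel]
  -- The equation `A S x = z S x - x` reads `S x = R ((z + 1) S x - x)` on the graph, so domains
  -- disappear from both inverse conditions.
  have key : ∀ z : ℂ, (∃ S : H →L[ℂ] H,
      (∀ x : H, ∃ h : S x ∈ A.domain, z • S x - A ⟨S x, h⟩ = x) ∧
      ∀ x : A.domain, S (z • (x : H) - A x) = x) ↔
      ∃ S : H →L[ℂ] H, S = R * ((z + 1) • S - 1) ∧ R = S * ((z + 1) • R - 1) := by
    intro z
    refine exists_congr fun S => and_congr ⟨fun h => ?_, fun h x => ?_⟩ ⟨fun h => ?_, fun h x => ?_⟩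
    · ext x
      obtain ⟨hd, hx⟩ := h x
      have h1 := (hR _ _).1 (A.mem_graph ⟨S x, hd⟩)
      refine h1.trans ?_
      simp only [mul_apply_eq_comp, sub_apply, smul_apply, one_apply_eq_self]
      congr 1
      rw [← sub_eq_iff_eq_add.2 (sub_eq_iff_eq_add'.1 hx), add_smul, one_smul]
      abel
    · have h1 : (S x, z • S x - x) ∈ A.graph := by
        rw [hR]
        have := congrArg (fun T : H →L[ℂ] H => T x) h
        simp only [mul_apply_eq_comp, sub_apply, smul_apply, one_apply_eq_self] at this
        refine this.trans ?_
        congr 1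
        rw [add_smul, one_smul]
        abel
      obtain ⟨y, hy, hy'⟩ := (LinearPMap.mem_graph_iff _).1 h1
      simp only at hy hy'
      refine ⟨hy ▸ y.2, ?_⟩
      have : (⟨S x, hy ▸ y.2⟩ : A.domain) = y := Subtype.ext hy.symm
      rw [this, hy', sub_sub_cancel]
    · ext v
      obtain ⟨y, hy, hy'⟩ := (LinearPMap.mem_graph_iff _).1 (hgraph v)
      simp only at hy hy'
      have h1 := h y
      rw [hy, hy'] at h1
      simp only [mul_apply_eq_comp, sub_apply, smul_apply, one_apply_eq_self]
      rw [← h1]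
      congr 1
      rw [h1, add_smul, one_smul]
      abel
    · have h1 := (hR _ _).1 (A.mem_graph x)
      set v := (x : H) + A x with hv
      have h2 : A x = v - R v := by rw [← h1, hv, add_sub_cancel_left]
      have := congrArg (fun T : H →L[ℂ] H => T v) h
      simp only [mul_apply_eq_comp, sub_apply, smul_apply, one_apply_eq_self] at this
      rw [h2, h1]
      refine Eq.trans ?_ this.symm
      congr 1
      rw [add_smul, one_smul]
      abel
  ext z
  rw [operatorSpectrum, Set.mem_ofPred_eq, Set.mem_ofPred_eq, key, not_iff_comm, not_and_or, not_not,
    spectrum.notMem_iff]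
  by_cases hz : z = -1
  · simp only [hz, true_or, true_iff]
    -- At `z = -1`, `z - A = -(1 + A)`.
    exact ⟨-R, by simp⟩
  · simp only [hz, false_or]
    have hs : z + 1 ≠ 0 := fun h => hz (eq_neg_of_add_eq_zero_left h)
    set s := z + 1 with hsdef
    constructor
    · intro hu
      obtain ⟨U, hU1, hU2⟩ := isUnit_iff_exists.1 hu
      rw [Algebra.algebraMap_eq_smul_one] at hU1 hU2
      -- Formally `z - A = s - R⁻¹ = -s (s⁻¹ - R) R⁻¹`, with `U = (s⁻¹ - R)⁻¹`.
      refine ⟨-(s⁻¹ • (R * U)), ?_, ?_⟩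
      · have h1 : R * U = s⁻¹ • U - 1 := by
          rw [sub_mul, smul_mul_assoc, one_mul] at hU1
          rw [← hU1]; abel
        have h2 : s • -(s⁻¹ • (R * U)) - 1 = -(s⁻¹ • U) := by
          rw [smul_neg, smul_smul, mul_inv_cancel₀ hs, one_smul, h1]; abel
        rw [h2, mul_neg, mul_smul_comm]
      · have h1 : s • R - 1 = -(s • (s⁻¹ • 1 - R)) := by
          rw [smul_sub, smul_smul, mul_inv_cancel₀ hs, one_smul]; abel
        rw [h1, neg_mul_neg, smul_mul_smul_comm, inv_mul_cancel₀ hs, one_smul, mul_assoc, hU2,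
          mul_one]
    · rintro ⟨S, h1, h2⟩
      have h1' : s • (R * S) = S + R := by
        conv_rhs => rw [h1]
        rw [mul_sub, mul_one, mul_smul_comm]; abel
      have h2' : s • (S * R) = S + R := by
        conv_rhs => rw [h2]
        rw [mul_sub, mul_one, mul_smul_comm]; abel
      -- The relations `s R S = S + R = s S R` say that `1 - s S` inverts `1 - s R`.
      refine isUnit_iff_exists.2 ⟨s • (1 - s • S), ?_, ?_⟩
      · calc _ = (1 - s • R) * (1 - s • S) := by
              rw [Algebra.algebraMap_eq_smul_one, mul_smul_comm, ← smul_mul_assoc, smul_sub,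
                smul_smul, mul_inv_cancel₀ hs, one_smul]
          _ = 1 - s • S - s • R + s • (s • (R * S)) := by
              simp only [sub_mul, mul_sub, one_mul, mul_one, smul_mul_assoc, mul_smul_comm, smul_sub]
              abel
          _ = 1 := by
              rw [h1', smul_add]
              abel
      · calc _ = (1 - s • S) * (1 - s • R) := by
              rw [Algebra.algebraMap_eq_smul_one, smul_mul_assoc, ← mul_smul_comm, smul_sub,
                smul_smul, mul_inv_cancel₀ hs, one_smul]
          _ = 1 - s • S - s • R + s • (s • (S * R)) := by
              simp only [sub_mul, mul_sub, one_mul, mul_one, smul_mul_assoc, mul_smul_comm, smul_sub]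
              abel
          _ = 1 := by
              rw [h2', smul_add]
              abel

end ResolventSpectrum

/-! ### Normality of `A` implies normality of `R`. -/

section Normal

variable {H : Type*} [NormedAddCommGroup H] [InnerProductSpace ℂ H] [CompleteSpace H]

/-- This is `A* = (R*)⁻¹ - 1`: every element of the domain of `A` is some `R v`, with `A R v = v - R
v`, and testing on these gives the equation. -/
theorem LinearPMap.mem_adjoint_graph_iff_of_resolvent {A : H →ₗ.[ℂ] H} {R : H →L[ℂ] H}
    (hR : ∀ x y, (x, y) ∈ A.graph ↔ x = R (x + y)) (hA : Dense (A.domain : Set H)) (x y : H) :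
    (x, y) ∈ A†.graph ↔ x = R.adjoint (x + y) := by
  have h1 : (x, y) ∈ A†.graph ↔ ∀ u : A.domain, inner ℂ y (u : H) = inner ℂ x (A u) := by
    rw [LinearPMap.mem_graph_iff]
    constructor
    · rintro ⟨w, rfl, rfl⟩ u
      exact LinearPMap.adjoint_isFormalAdjoint hA w u
    · intro h
      exact ⟨⟨x, LinearPMap.mem_adjoint_domain_of_exists x ⟨y, h⟩⟩, rfl,
        LinearPMap.adjoint_apply_eq hA _ h⟩
  rw [h1]
  constructor
  · intro h
    refine ext_inner_right ℂ fun v => ?_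
    rw [ContinuousLinearMap.adjoint_inner_left]
    have hv : (R v, v - R v) ∈ A.graph := by rw [hR, add_sub_cancel]
    obtain ⟨u, hu, hu'⟩ := (LinearPMap.mem_graph_iff _).1 hv
    have := h u
    simp only at hu hu'
    rw [hu, hu', inner_sub_right] at this
    rw [inner_add_left, this]
    ring
  · intro h u
    have h2 := (hR _ _).1 (A.mem_graph u)
    have h3 : inner ℂ x ((u : H) + A u) = inner ℂ (x + y) (u : H) := by
      conv_lhs => rw [h]
      rw [ContinuousLinearMap.adjoint_inner_left, ← h2]
    rw [inner_add_left, inner_add_right] at h3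
    exact (add_left_cancel h3).symm

/-- The kernel of `R*` is orthogonal to the range of `R`, which contains the dense domain. -/
theorem adjoint_injective_of_resolvent {A : H →ₗ.[ℂ] H} {R : H →L[ℂ] H}
    (hR : ∀ x y, (x, y) ∈ A.graph ↔ x = R (x + y)) (hA : Dense (A.domain : Set H)) :
    Function.Injective R.adjoint := by
  rw [injective_iff_map_eq_zero]
  intro x hx
  refine hA.eq_zero_of_inner_left ℂ fun u hu => ?_
  have h2 : u = R (u + A ⟨u, hu⟩) := (hR _ _).1 (A.mem_graph ⟨u, hu⟩)
  rw [h2, ← ContinuousLinearMap.adjoint_inner_left, hx, inner_zero_left]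

/-- If `R` and `R*` are injective and the operator `A = R⁻¹ - 1` satisfies `A A* = A* A`, then `R`
is normal. -/
theorem commute_adjoint_of_graph {R : H →L[ℂ] H} (hinj : Function.Injective R)
    (hinj' : Function.Injective R.adjoint)
    (h : ∀ x y, (∃ z, x = R.adjoint (x + z) ∧ z = R (z + y)) ↔
      ∃ z, x = R (x + z) ∧ z = R.adjoint (z + y)) :
    Commute R.adjoint R := by
  set R' := R.adjoint with hR'
  have hstar : star R = R' := ContinuousLinearMap.star_eq_adjoint R
  have hstar' : star R' = R := by rw [← hstar, star_star]
  -- For `a = p + A p`, so that `p = R a`, one has `S a = R* (p + A* A p)`. Hence `M = R S⁻¹ R*`,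
  -- formed below, is `(1 + A* A)⁻¹`. The inverse of `S` exists since `2 S ≥ 1`.
  let S : H →L[ℂ] H := R' * R + (1 - R') * (1 - R)
  have hS2 : (2 : ℂ) • S = 1 + star (1 - (2 : ℂ) • R) * (1 - (2 : ℂ) • R) := by
    have : star ((2 : ℂ) • R) = (2 : ℂ) • R' := by rw [star_smul, hstar]; simp
    rw [star_sub, star_one, this]
    simp only [S, two_smul]
    noncomm_ring
  have hSu : IsUnit S := by
    have h1 : IsUnit ((2 : ℂ) • S) := by
      rw [hS2]
      exact ((isStrictlyPositive_one).add_nonneg (star_mul_self_nonneg _)).isUnit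
    have h2 : S = (2⁻¹ : ℂ) • ((2 : ℂ) • S) := by rw [smul_smul]; norm_num
    rw [h2]
    exact (h1.smul (Units.mk0 (2⁻¹ : ℂ) (by norm_num)))
  obtain ⟨V, hV1, hV2⟩ := isUnit_iff_exists.1 hSu
  have hSs : star S = S := by
    simp only [S, star_add, star_mul, star_sub, star_one, hstar, hstar']
  have hVs : star V = V := by
    have h1 : star V * S = 1 := by rw [← hSs, ← star_mul, hV1, star_one]
    exact left_inv_eq_right_inv h1 hV1
  obtain ⟨M, hM⟩ : ∃ M, M = R * V * R' := ⟨_, rfl⟩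
  have hMs : star M = M := by simp only [hM, star_mul, hVs, hstar, hstar', mul_assoc]
  have hSapp : ∀ a, S a = R' (R a) + ((a - R a) - R' (a - R a)) := fun a => by simp [S]
  have hVapp : ∀ a, V (S a) = a := fun a => by rw [← mul_apply_eq_comp, hV2, one_apply_eq_self]
  have hVapp' : ∀ a, S (V a) = a := fun a => by rw [← mul_apply_eq_comp, hV1, one_apply_eq_self]
  have hMapp : ∀ x, M x = R (V (R' x)) := fun x => by rw [hM]; rfl
  have hN : ∀ p y, (∃ z, p = R (p + z) ∧ z = R' (z + y)) ↔ p = M (p + y) := by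
    intro p y
    constructor
    · rintro ⟨z, h1, h2⟩
      have h3 : S (p + z) = R' (p + y) := by
        rw [hSapp, ← h1, add_sub_cancel_left, map_add R' p y]
        conv_lhs => enter [2, 1]; rw [h2]
        rw [map_add]
        abel
      rw [hMapp, ← h3, hVapp]
      exact h1
    · intro h1
      set a := V (R' (p + y)) with ha
      have h2 : p = R a := by rw [ha, ← hMapp]; exact h1
      have h3 : S a = R' (p + y) := hVapp' _
      refine ⟨a - p, by rw [add_sub_cancel]; exact h2, ?_⟩
      rw [hSapp, ← h2] at h3
      rw [map_add] at h3 ⊢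
      rw [← sub_eq_iff_eq_add'] at h3
      rw [← sub_eq_zero] at h3 ⊢
      rw [← h3]
      abel
  -- For `p = M R x` and `z = A p`, applying `A` to `A* z = R x - p` gives `A A* z = x - R x - z`.
  -- Normality replaces `A A*` by `A* A`, so `z = M (x - R x) = M x - p`, and then `R (M x) = R (p +
  -- z) = p`.
  have hMR : ∀ x, M (R x) = R (M x) := by
    intro x
    set p := M (R x) with hp
    obtain ⟨z, h1, h2⟩ := (hN p (R x - p)).2 (by rw [add_sub_cancel])
    have h3 : ∃ w, z = R' (z + w) ∧ w = R (w + (x - R x - z)) := by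
      refine ⟨R x - p, h2, ?_⟩
      have : R x - p + (x - R x - z) = x - (p + z) := by abel
      rw [this, map_sub, ← h1]
    have h4 := (hN _ _).1 ((h _ _).1 h3)
    rw [add_sub_cancel, map_sub, ← hp] at h4
    have h5 : M x = p + z := by rw [h4]; abel
    rw [h5, ← h1]
  have hcMR : M * R = R * M := ContinuousLinearMap.ext hMR
  have hcMR' : M * R' = R' * M := by
    have := congrArg star hcMR
    rw [star_mul, star_mul, hMs, hstar] at this
    exact this.symm
  have hMinj : ∀ v, M v = 0 → v = 0 := by
    intro v hv
    obtain ⟨z, h1, h2⟩ := (hN 0 v).2 (by rw [zero_add, hv])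
    rw [zero_add] at h1
    have hz : z = 0 := hinj (by rw [← h1, map_zero])
    rw [hz, zero_add] at h2
    exact hinj' (by rw [← h2, map_zero])
  -- The vector `q = R R* M v` also equals `M R R* v`, so `A* A q = y = A A* q`. With `w = A q` and
  -- `z = A* q`, `M v = q + z + w + y`, on which `R* R` and `R R*` both give `q`.
  have hcM : (R' * R - R * R') * M = 0 := by
    ext v
    set q := R (R' (M v)) with hq
    have hqM : q = M (R (R' v)) := by
      rw [hMR, ← mul_apply_eq_comp M, hcMR', hq]; rfl
    have h0 : ∃ z, q = R (q + z) ∧ z = R' (z + (R (R' v) - q)) :=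
      (hN _ _).2 (by rw [add_sub_cancel]; exact hqM)
    set y := R (R' v) - q
    obtain ⟨z, h1, h2⟩ := (h _ _).2 h0
    obtain ⟨w, h3, h4⟩ := h0
    have h5 : R' (M v) = q + w := hinj (by rw [← h3])
    have h6 : M v = (q + z) + (w + y) := hinj' (by rw [h5, map_add, ← h1, ← h4])
    have h7 : R (M v) = q + z := by
      have : q + z + (w + y) = (q + w) + (z + y) := by abel
      rw [h6, this, map_add, ← h3, ← h2]
    have h8 : R' (R (M v)) = q := by rw [h7, ← h1]
    change R' (R (M v)) - R (R' (M v)) = 0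
    rw [h8, ← hq, sub_self]
  have hc : R' * R - R * R' = 0 := by
    -- The commutator and `M` are self-adjoint, so taking adjoints puts `M` on the left, where
    -- injectivity cancels it.
    have h1 := congrArg star hcM
    rw [star_mul, hMs, star_zero, star_sub, star_mul, star_mul, hstar, hstar'] at h1
    ext v
    exact hMinj _ (congrArg (fun T : H →L[ℂ] H => T v) h1)
  exact sub_eq_zero.1 hc

end Normal

namespace ContractionSemigroup

variable {H : Type*} [NormedAddCommGroup H] [InnerProductSpace ℂ H] [CompleteSpace H]

theorem operatorSpectrum_operatorA (P : ContractionSemigroup ℂ H) :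
    operatorSpectrum P.operatorA = {z | z ≠ -1 ∧ (z + 1)⁻¹ ∈ spectrum ℂ P.resolvent} :=
  operatorSpectrum_eq_of_resolvent fun _ _ => P.mem_graph_operatorA_iff_resolvent

theorem IsNormal.isStarNormal_resolvent {P : ContractionSemigroup ℂ H} (hP : P.IsNormal) :
    IsStarNormal P.resolvent := by
  have hR := fun x y => P.mem_graph_operatorA_iff_resolvent (x := x) (y := y)
  have hR' := LinearPMap.mem_adjoint_graph_iff_of_resolvent hR hP.1
  refine ⟨commute_adjoint_of_graph P.resolvent_injective
    (adjoint_injective_of_resolvent hR hP.1) fun x y => ?_⟩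
  have := hP.2 x y
  simpa only [hR, hR'] using this

theorem spectrum_resolvent_eq {K : Type*} [NormedAddCommGroup K] [InnerProductSpace ℂ K]
    [CompleteSpace K] {P : ContractionSemigroup ℂ H} {Q : ContractionSemigroup ℂ K}
    {e : K ≃L[ℂ] H} (he : ∀ t f, P.op t (e f) = e (Q.op t f)) :
    spectrum ℂ P.resolvent = spectrum ℂ Q.resolvent := by
  rw [← AlgEquiv.spectrum_eq e.conjContinuousAlgEquiv Q.resolvent]
  congr 1
  ext x
  obtain ⟨y, rfl⟩ := e.surjective x
  simp [resolvent_apply_equiv he]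

end ContractionSemigroup

/-! ### Integration against a complex multiple of a positive measure. -/

section ComplexMeasure

variable {Y : Type*} [MeasurableSpace Y]

/-- The complex measure `c μ`. -/
def MeasureTheory.Measure.complexMulMeasure (μ : Measure Y) [IsFiniteMeasure μ] (c : ℂ) :
    ComplexMeasure Y :=
  μ.toSignedMeasure.mapRange (c • Complex.ofRealCLM : ℝ →L[ℝ] ℂ).toLinearMap.toAddMonoidHom
    (c • Complex.ofRealCLM : ℝ →L[ℝ] ℂ).continuous

theorem complexMulMeasure_apply (μ : Measure Y) [IsFiniteMeasure μ] (c : ℂ) {Ω : Set Y}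
    (hΩ : MeasurableSet Ω) : μ.complexMulMeasure c Ω = c * (μ.real Ω : ℂ) := by
  simp [Measure.complexMulMeasure, VectorMeasure.mapRange_apply,
    Measure.toSignedMeasure_apply_measurable hΩ]

theorem variation_complexMulMeasure_le (μ : Measure Y) [IsFiniteMeasure μ] (c : ℂ) :
    (μ.complexMulMeasure c).variation ≤ ‖c‖ₑ • μ := by
  refine VectorMeasure.variation_le_of_forall_enorm_le fun Ω hΩ => ?_
  rw [complexMulMeasure_apply μ c hΩ, enorm_mul, Measure.smul_apply, smul_eq_mul]
  gcongr
  rw [← ofReal_norm, Complex.norm_real, Real.norm_of_nonneg measureReal_nonneg,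
    ofReal_measureReal]

theorem integrable_complexMulMeasure {μ : Measure Y} [IsFiniteMeasure μ] (c : ℂ) {f : Y → ℂ}
    (hf : Integrable f μ) : (μ.complexMulMeasure c).Integrable f :=
  hf.of_measure_le_smul enorm_ne_top (variation_complexMulMeasure_le μ c)

/-- Both sides are `setToFun` of one set function, but dominated by different measures, `μ` and the
variation of `c μ`; the bound of the latter by `‖c‖ μ` reconciles them. -/
theorem integral_complexMulMeasure {μ : Measure Y} [IsFiniteMeasure μ] (c : ℂ) {f : Y → ℂ}
    (hf : Integrable f μ) :
    (μ.complexMulMeasure c).integral f (ContinuousLinearMap.mul ℝ ℂ) = c * ∫ y, f y ∂μ := by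
  let B : ℂ →L[ℝ] ℝ →L[ℝ] ℂ :=
    (ContinuousLinearMap.compL ℝ ℝ ℂ ℂ (ContinuousLinearMap.mul ℝ ℂ c)) ∘L
      (ContinuousLinearMap.lsmul ℝ ℝ).flip
  have hT : μ.toSignedMeasure.transpose B =
      (μ.complexMulMeasure c).transpose (ContinuousLinearMap.mul ℝ ℂ) := by
    ext Ω hΩ : 1
    ext x
    change B x (μ.toSignedMeasure Ω) = x * (μ.complexMulMeasure c Ω)
    rw [complexMulMeasure_apply μ c hΩ, Measure.toSignedMeasure_apply_measurable hΩ]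
    simp [B]
    ring
  have hD : DominatedFinMeasAdditive μ.toSignedMeasure.variation
      ((μ.complexMulMeasure c).transpose (ContinuousLinearMap.mul ℝ ℂ)) ‖B‖ :=
    hT ▸ dominatedFinMeasAdditive_cbmApplyMeasure μ.toSignedMeasure B
  have hf' : Integrable f μ.toSignedMeasure.variation := by simpa using hf
  have h1 := setToFun_congr_measure_of_integrable ‖c‖ₑ enorm_ne_top
    (by simpa using variation_complexMulMeasure_le μ c) hD
    (dominatedFinMeasAdditive_cbmApplyMeasure (μ.complexMulMeasure c)
      (ContinuousLinearMap.mul ℝ ℂ)) f hf'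
  have h2 : μ.toSignedMeasure.integral f B = c * ∫ y, f y ∂μ := by
    rw [← VectorMeasure.continuousLinearMap_apply_integral hf',
      VectorMeasure.integral_toSignedMeasure]
    rfl
  rw [VectorMeasure.integral_eq_setToFun, ← h1, ← h2, VectorMeasure.integral_eq_setToFun]
  exact setToFun_congr_left _ _ (by rw [hT]) f

end ComplexMeasure

/-! ### Uniqueness for the Cauchy problem. -/

namespace ContractionSemigroup

variable {H : Type*} [NormedAddCommGroup H] [InnerProductSpace ℂ H]

theorem continuous_op_uncurry (P : ContractionSemigroup ℂ H) :
    Continuous fun p : ℝ≥0 × H => P.op p.1 p.2 := by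
  rw [continuous_iff_continuousAt]
  rintro ⟨t, x⟩
  rw [ContinuousAt, tendsto_iff_norm_sub_tendsto_zero]
  have h1 : Tendsto (fun p : ℝ≥0 × H => ‖p.2 - x‖ + ‖P.op p.1 x - P.op t x‖) (𝓝 (t, x))
      (𝓝 0) := by
    have hc : Continuous fun p : ℝ≥0 × H => ‖p.2 - x‖ + ‖P.op p.1 x - P.op t x‖ := by
      have := (P.continuous_op_apply x).comp (continuous_fst (X := ℝ≥0) (Y := H))
      exact (continuous_snd.sub continuous_const).norm.add (this.sub continuous_const).norm
    simpa using hc.tendsto (t, x)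
  refine squeeze_zero (fun _ => norm_nonneg _) (fun p => ?_) h1
  have : P.op p.1 p.2 - P.op t x = P.op p.1 (p.2 - x) + (P.op p.1 x - P.op t x) := by
    rw [map_sub]
    abel
  rw [this]
  exact (norm_add_le _ _).trans (by gcongr; exact P.norm_op_apply_le _ _)

/-- Uniqueness for the Cauchy problem `v' = -A v`. -/
theorem op_apply_eq_of_hasDerivWithinAt (P : ContractionSemigroup ℂ H) {v a : ℝ → H}
    (hc : Continuous v) (hd : ∀ s, 0 ≤ s → HasDerivWithinAt v (-a s) (Set.Ici s) s)
    (hg : ∀ s, 0 ≤ s → (v s, a s) ∈ P.operatorA.graph) {t : ℝ} (ht : 0 ≤ t) :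
    P.op t.toNNReal (v 0) = v t := by
  have hcu : Continuous fun s : ℝ => P.op (t - s).toNNReal (v s) := by
    have : Continuous fun s : ℝ => ((t - s).toNNReal, v s) := by fun_prop
    exact P.continuous_op_uncurry.comp this
  -- The curve `s ↦ P_{t-s} v(s)` has zero right derivative: its increment from `s` to `y` is
  -- `P_{t-y} (v(y) - P_{y-s} v(s))`, and the bracket is `o(y - s)` because both terms have right
  -- derivative `-a s`.
  have key := constant_of_has_deriv_right_zero (a := 0) (b := t) hcu.continuousOn ?_ t
    ⟨ht, le_rfl⟩
  · simpa [P.op_zero] using key.symm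
  rintro s ⟨hs0, hst⟩
  have h1 := (P.tendsto_diffQuot_iff).1 ((P.mem_graph_operatorA_iff).1 (hg s hs0))
  have h2 : HasDerivWithinAt (fun y : ℝ => P.op (y - s).toNNReal (v s)) (-a s) (Set.Ioi s) s := by
    have h3 : HasDerivWithinAt (fun t : ℝ => P.op t.toNNReal (v s)) (-a s) (Set.Ioi 0) (s - s) := by
      simpa using h1
    have := HasDerivWithinAt.scomp (h := fun y => y - s) (s := Set.Ioi s) s h3
      ((hasDerivWithinAt_id s (Set.Ioi s)).sub_const s)
      (fun y hy => sub_pos.2 (Set.mem_Ioi.1 hy))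
    rw [one_smul] at this
    exact this
  have h4 := (((hd s hs0).mono Set.Ioi_subset_Ici_self).sub h2)
  rw [sub_self, hasDerivWithinAt_iff_isLittleO] at h4
  rw [← hasDerivWithinAt_Ioi_iff_Ici, hasDerivWithinAt_iff_isLittleO]
  refine Asymptotics.IsBigO.trans_isLittleO ?_ h4
  refine Asymptotics.IsBigO.of_bound 1 ?_
  have hev : ∀ᶠ y in 𝓝[>] s, y ∈ Set.Ioo s t := Ioo_mem_nhdsGT hst
  filter_upwards [hev] with y hy
  have h5 : (t - s).toNNReal = (t - y).toNNReal + (y - s).toNNReal := by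
    rw [← Real.toNNReal_add (by linarith [hy.2]) (by linarith [hy.1])]
    congr 1
    ring
  simp only [smul_zero, sub_zero, one_mul, Pi.sub_apply, sub_self, Real.toNNReal_zero, P.op_zero]
  rw [h5, P.op_add, ContinuousLinearMap.comp_apply, ← map_sub]
  simpa using P.norm_op_apply_le (t - y).toNNReal (v y - P.op (y - s).toNNReal (v s))

end ContractionSemigroup

/-- The bound must hold for all `z` in the half-plane since `γ` is unbounded. The constant `3` comes
from `1 + 1 + ‖z‖ ≤ 3 ‖z‖²` when `1 ≤ ‖z‖`. -/
theorem Complex.norm_exp_neg_sub_one_add_le {z : ℂ} (hz : 0 ≤ z.re) :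
    ‖Complex.exp (-z) - 1 + z‖ ≤ 3 * ‖z‖ ^ 2 := by
  rcases le_total ‖z‖ 1 with h | h
  · have := Complex.norm_exp_sub_one_sub_id_le (x := -z) (by simpa using h)
    rw [norm_neg, sub_neg_eq_add] at this
    nlinarith [norm_nonneg z]
  · have h1 : ‖Complex.exp (-z)‖ ≤ 1 := by
      rw [Complex.norm_exp]
      simpa using hz
    calc _ ≤ ‖Complex.exp (-z)‖ + ‖(1 : ℂ)‖ + ‖z‖ :=
          (norm_add_le _ _).trans (by gcongr; exact norm_sub_le _ _)
      _ ≤ 1 + 1 + ‖z‖ := by rw [norm_one]; gcongr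
      _ ≤ _ := by nlinarith

/-! ### The functions `e^{-tγ} w` with `γ = w⁻¹ - 1`; here `‖w‖² ≤ Re w` encodes `Re γ ≥ 0` off the
zeros. -/

section ExpMul

theorem Complex.re_inv_sub_one_nonneg {z : ℂ} (hz : z ≠ 0) (h : ‖z‖ ^ 2 ≤ z.re) :
    0 ≤ (z⁻¹ - 1).re := by
  have h0 : 0 < Complex.normSq z := Complex.normSq_pos.2 hz
  rw [Complex.sub_re, Complex.inv_re, Complex.one_re, sub_nonneg, le_div_iff₀ h0, one_mul,
    Complex.normSq_eq_norm_sq]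
  exact h

theorem Complex.norm_exp_neg_inv_sub_one_mul_le {z : ℂ} (hz : z ≠ 0) (h : ‖z‖ ^ 2 ≤ z.re)
    (t : ℝ≥0) : ‖Complex.exp (-(z⁻¹ - 1) * ((t : ℝ) : ℂ))‖ ≤ 1 := by
  rw [Complex.norm_exp, neg_mul, Complex.neg_re, Complex.re_mul_ofReal, Real.exp_le_one_iff,
    neg_nonpos]
  exact mul_nonneg (Complex.re_inv_sub_one_nonneg hz h) t.2

theorem Complex.norm_exp_neg_inv_sub_one_mul_mul_le {z : ℂ} (h : ‖z‖ ^ 2 ≤ z.re) (t : ℝ≥0) :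
    ‖Complex.exp (-(z⁻¹ - 1) * ((t : ℝ) : ℂ)) * z‖ ≤ ‖z‖ := by
  by_cases hz : z = 0
  · simp [hz]
  · rw [norm_mul]
    exact mul_le_of_le_one_left (norm_nonneg _)
      (Complex.norm_exp_neg_inv_sub_one_mul_le hz h t)

theorem Complex.norm_one_sub_le_one {z : ℂ} (h : ‖z‖ ^ 2 ≤ z.re) : ‖1 - z‖ ≤ 1 := by
  have h1 : ‖1 - z‖ ^ 2 ≤ 1 := by
    rw [← Complex.normSq_eq_norm_sq, Complex.normSq_apply] at *
    simp only [Complex.sub_re, Complex.one_re, Complex.sub_im, Complex.one_im]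
    nlinarith [mul_self_nonneg z.re, mul_self_nonneg z.im]
  nlinarith [norm_nonneg (1 - z)]

variable {X : Type*} [TopologicalSpace X]

/-- Near a zero of `w` the product is bounded by `‖w‖`, so the default value `0⁻¹ = 0` does no harm.
-/
theorem continuous_exp_neg_inv_sub_one_mul_mul {w : C(X, ℂ)} (hre : ∀ x, ‖w x‖ ^ 2 ≤ (w x).re) :
    Continuous fun p : ℝ≥0 × X =>
      Complex.exp (-((w p.2)⁻¹ - 1) * ((p.1 : ℝ) : ℂ)) * w p.2 := by
  rw [continuous_iff_continuousAt]
  rintro ⟨t, x⟩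
  by_cases hx : w x = 0
  · have h1 : Tendsto (fun p : ℝ≥0 × X => ‖w p.2‖) (𝓝 (t, x)) (𝓝 0) := by
      have : Continuous fun p : ℝ≥0 × X => ‖w p.2‖ := by fun_prop
      simpa [hx] using this.tendsto (t, x)
    rw [ContinuousAt]
    simp only [hx, mul_zero]
    exact squeeze_zero_norm
      (fun p => Complex.norm_exp_neg_inv_sub_one_mul_mul_le (hre p.2) p.1) h1
  · have h1 : ContinuousAt (fun p : ℝ≥0 × X => w p.2) (t, x) :=
      (by fun_prop : Continuous fun p : ℝ≥0 × X => w p.2).continuousAt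
    have h2 : ContinuousAt (fun p : ℝ≥0 × X => ((p.1 : ℝ) : ℂ)) (t, x) :=
      (by fun_prop : Continuous fun p : ℝ≥0 × X => ((p.1 : ℝ) : ℂ)).continuousAt
    exact (((h1.inv₀ hx).sub continuousAt_const).neg.mul h2).cexp.mul h1

/-- The continuous functions `e^{-t(w⁻¹ - 1)} w`, for `t ≥ 0`. -/
def expMul {w : C(X, ℂ)} (hre : ∀ x, ‖w x‖ ^ 2 ≤ (w x).re) : C(ℝ≥0, C(X, ℂ)) :=
  ContinuousMap.curry ⟨_, continuous_exp_neg_inv_sub_one_mul_mul hre⟩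

theorem expMul_apply {w : C(X, ℂ)} (hre : ∀ x, ‖w x‖ ^ 2 ≤ (w x).re) (t : ℝ≥0) (x : X) :
    expMul hre t x = Complex.exp (-((w x)⁻¹ - 1) * ((t : ℝ) : ℂ)) * w x := rfl

/-- The second factor `w` makes the Taylor remainder uniform in `x`: it is of size `h² ‖γ w‖²`, and
`γ w = 1 - w` is bounded by `1`. -/
theorem norm_expMul_sub_le {w : C(X, ℂ)} (hre : ∀ x, ‖w x‖ ^ 2 ≤ (w x).re) (s h : ℝ≥0) (x : X) :
    ‖(expMul hre (s + h) x - expMul hre s x) * w x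
      + ((h : ℝ) : ℂ) * (expMul hre s x * (1 - w x))‖ ≤ 3 * (h : ℝ) ^ 2 := by
  rw [expMul_apply, expMul_apply]
  by_cases hx : w x = 0
  · simp [hx]
  set z := w x
  set γ := z⁻¹ - 1 with hγ
  have hz1 : γ * z = 1 - z := by rw [hγ, sub_mul, inv_mul_cancel₀ hx, one_mul]
  have h1 : Complex.exp (-γ * (((s + h : ℝ≥0) : ℝ) : ℂ)) =
      Complex.exp (-γ * ((s : ℝ) : ℂ)) * Complex.exp (-(γ * ((h : ℝ) : ℂ))) := by
    rw [← Complex.exp_add]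
    congr 1
    push_cast
    ring
  have h2 : (Complex.exp (-γ * (((s + h : ℝ≥0) : ℝ) : ℂ)) * z
        - Complex.exp (-γ * ((s : ℝ) : ℂ)) * z) * z
      + ((h : ℝ) : ℂ) * (Complex.exp (-γ * ((s : ℝ) : ℂ)) * z * (1 - z)) =
      (Complex.exp (-γ * ((s : ℝ) : ℂ)) * z) *
        ((Complex.exp (-(γ * ((h : ℝ) : ℂ))) - 1 + γ * ((h : ℝ) : ℂ)) * z) := by
    rw [h1, ← hz1]
    ring
  have h3 : ‖Complex.exp (-(γ * ((h : ℝ) : ℂ))) - 1 + γ * ((h : ℝ) : ℂ)‖ ≤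
      3 * ‖γ * ((h : ℝ) : ℂ)‖ ^ 2 := by
    refine Complex.norm_exp_neg_sub_one_add_le ?_
    rw [Complex.re_mul_ofReal]
    exact mul_nonneg (Complex.re_inv_sub_one_nonneg hx (hre x)) h.2
  have h4 : ‖Complex.exp (-γ * ((s : ℝ) : ℂ)) * z‖ ≤ ‖z‖ :=
    Complex.norm_exp_neg_inv_sub_one_mul_mul_le (hre x) s
  have h5 : ‖1 - z‖ ≤ 1 := Complex.norm_one_sub_le_one (hre x)
  have h6 : ‖((h : ℝ) : ℂ)‖ = h := by simp
  rw [h2, norm_mul]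
  calc _ ≤ ‖z‖ * (3 * ‖γ * ((h : ℝ) : ℂ)‖ ^ 2 * ‖z‖) :=
        mul_le_mul h4 (by rw [norm_mul]; gcongr) (norm_nonneg _) (norm_nonneg _)
    _ = 3 * (h : ℝ) ^ 2 * ‖γ * z‖ ^ 2 := by
        rw [norm_mul, norm_mul, h6]
        ring
    _ ≤ 3 * (h : ℝ) ^ 2 * 1 ^ 2 := by rw [hz1]; gcongr
    _ = _ := by ring

end ExpMul

/-! ### The semigroup inside the functional calculus of its resolvent. -/

namespace ContractionSemigroup

variable {X : Type*} [TopologicalSpace X] [CompactSpace X]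
  {K : Type*} [NormedAddCommGroup K] [InnerProductSpace ℂ K] [CompleteSpace K]
  {Q : ContractionSemigroup ℂ K} {Φ : C(X, ℂ) →⋆ₐ[ℂ] (K →L[ℂ] K)} {w : C(X, ℂ)}

/-- The curve `v(s) = Φ(e^{-sγ} w) R f` solves `v' = -A v` with `v(0) = R² f`. The extra `R` puts
`v` in the domain of `A` and gives differentiability in norm; `op_mul_resolvent` cancels it by
injectivity. -/
theorem op_mul_resolvent_sq (hw : Φ w = Q.resolvent) (hre : ∀ x, ‖w x‖ ^ 2 ≤ (w x).re)
    (t : ℝ≥0) (f : K) :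
    Q.op t (Q.resolvent (Q.resolvent f)) = Φ (expMul hre t) (Q.resolvent f) := by
  have hΦ : ∀ φ, ‖Φ φ‖ ≤ ‖φ‖ := NonUnitalStarAlgHom.norm_apply_le Φ
  have hΦc : Continuous Φ := AddMonoidHomClass.continuous_of_bound Φ 1 fun φ => by
    simpa using hΦ φ
  have hcomm : ∀ φ g, Φ φ (Q.resolvent g) = Q.resolvent (Φ φ g) := fun φ g => by
    rw [← hw, ← mul_apply_eq_comp, ← mul_apply_eq_comp, ← map_mul, mul_comm, map_mul]
  let v : ℝ → K := fun s => Φ (expMul hre s.toNNReal) (Q.resolvent f)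
  let a : ℝ → K := fun s => Φ (expMul hre s.toNNReal) (f - Q.resolvent f)
  have hv : Continuous v := by
    have : Continuous fun s : ℝ => Φ (expMul hre s.toNNReal) :=
      hΦc.comp ((expMul hre).continuous.comp continuous_real_toNNReal)
    exact this.clm_apply continuous_const
  have hg : ∀ s, 0 ≤ s → (v s, a s) ∈ Q.operatorA.graph := by
    intro s _
    have := Q.mem_graph_resolvent (Φ (expMul hre s.toNNReal) f)
    rwa [← hcomm, ← map_sub] at this
  have hd : ∀ s, 0 ≤ s → HasDerivWithinAt v (-a s) (Set.Ici s) s := by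
    intro s hs
    rw [hasDerivWithinAt_iff_isLittleO]
    have hO : (fun y => v y - v s - (y - s) • (-a s)) =O[𝓝[≥] s] fun y => (y - s) ^ 2 := by
      refine Asymptotics.IsBigO.of_bound (3 * ‖f‖) ?_
      filter_upwards [self_mem_nhdsWithin] with y hy
      have hy' : 0 ≤ y - s := sub_nonneg.2 hy
      obtain ⟨h, hh⟩ : ∃ h : ℝ≥0, (h : ℝ) = y - s := ⟨⟨y - s, hy'⟩, rfl⟩
      have hys : y.toNNReal = s.toNNReal + h := by
        refine NNReal.eq ?_
        rw [Real.coe_toNNReal _ (hs.trans hy), NNReal.coe_add, Real.coe_toNNReal _ hs, hh]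
        ring
      let D : C(X, ℂ) := (expMul hre (s.toNNReal + h) - expMul hre s.toNNReal) * w
        + ((h : ℝ) : ℂ) • (expMul hre s.toNNReal * (1 - w))
      have hD : ‖D‖ ≤ 3 * (h : ℝ) ^ 2 :=
        (ContinuousMap.norm_le _ (by positivity)).2 fun x =>
          norm_expMul_sub_le hre s.toNNReal h x
      have hDf : v y - v s - (y - s) • (-a s) = Φ D f := by
        simp only [v, a, D, hys, ← hh, map_add, map_mul, map_sub, map_smul, map_one, hw]
        simp
        rw [sub_eq_add_neg _ (_ • _), ← smul_neg, neg_sub]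
      rw [hDf, ← hh, Real.norm_of_nonneg (by positivity)]
      calc ‖Φ D f‖ ≤ ‖Φ D‖ * ‖f‖ := (Φ D).le_opNorm f
        _ ≤ 3 * (h : ℝ) ^ 2 * ‖f‖ := by
            gcongr
            exact (hΦ D).trans hD
        _ = _ := by ring
    refine hO.trans_isLittleO ?_
    have h1 : Tendsto (fun y : ℝ => y - s) (𝓝[≥] s) (𝓝 0) := by
      have : Continuous fun y : ℝ => y - s := by fun_prop
      simpa using (this.tendsto s).mono_left nhdsWithin_le_nhds
    have h2 := (Asymptotics.isLittleO_one_iff ℝ).2 h1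
    simpa [sq] using h2.mul_isBigO (Asymptotics.isBigO_refl (fun y : ℝ => y - s) (𝓝[≥] s))
  have := Q.op_apply_eq_of_hasDerivWithinAt hv hd hg (t := (t : ℝ)) t.2
  simp only [v, Real.toNNReal_coe, Real.toNNReal_zero] at this
  rw [← this]
  have h0 : expMul hre 0 = w := by
    ext x
    simp [expMul_apply]
  rw [h0, hw]

theorem op_mul_resolvent (hw : Φ w = Q.resolvent) (hre : ∀ x, ‖w x‖ ^ 2 ≤ (w x).re) (t : ℝ≥0) :
    Q.op t * Q.resolvent = Φ (expMul hre t) := by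
  ext f
  refine Q.resolvent_injective ?_
  have h1 := op_mul_resolvent_sq hw hre t f
  have h2 := (Q.commute_op_resolvent t).eq
  have h3 : Φ (expMul hre t) * Q.resolvent = Q.resolvent * Φ (expMul hre t) := by
    rw [← hw, ← map_mul, ← map_mul, mul_comm]
  rw [← mul_apply_eq_comp, ← mul_apply_eq_comp Q.resolvent, ← mul_assoc, ← h2, mul_assoc,
    ← h3]
  exact h1

end ContractionSemigroup

/-! ### Removing the factor `w`. -/

section ApproxInv

variable {X : Type*} [TopologicalSpace X]

/-- Approximate inverses `conj w / (|w|² + 1 / (n + 1))` of `w`. -/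
def ContinuousMap.approxInv (w : C(X, ℂ)) (n : ℕ) : C(X, ℂ) where
  toFun x := (starRingEnd ℂ) (w x) / ((‖w x‖ ^ 2 + 1 / ((n : ℝ) + 1) : ℝ) : ℂ)
  continuous_toFun := by
    refine Continuous.div (by fun_prop) (by fun_prop) fun x => ?_
    rw [Ne, Complex.ofReal_eq_zero]
    positivity

theorem ContinuousMap.mul_approxInv_apply (w : C(X, ℂ)) (n : ℕ) (x : X) :
    w x * w.approxInv n x = ((‖w x‖ ^ 2 / (‖w x‖ ^ 2 + 1 / ((n : ℝ) + 1)) : ℝ) : ℂ) := by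
  change w x * ((starRingEnd ℂ) (w x) / _) = _
  rw [← mul_div_assoc, Complex.mul_conj, Complex.normSq_eq_norm_sq, ← Complex.ofReal_div]

theorem ContinuousMap.norm_mul_approxInv_le (w : C(X, ℂ)) (n : ℕ) (x : X) :
    ‖w x * w.approxInv n x‖ ≤ 1 := by
  rw [w.mul_approxInv_apply, Complex.norm_real, Real.norm_of_nonneg (by positivity)]
  refine div_le_one_of_le₀ ?_ (by positivity)
  exact le_add_of_nonneg_right (by positivity)

theorem ContinuousMap.tendsto_mul_approxInv (w : C(X, ℂ)) {x : X} (hx : w x ≠ 0) :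
    Tendsto (fun n => w x * w.approxInv n x) atTop (𝓝 1) := by
  simp only [w.mul_approxInv_apply]
  have hx' : ‖w x‖ ^ 2 + 0 ≠ 0 := by simpa using hx
  have h1 : Tendsto (fun n : ℕ => ‖w x‖ ^ 2 / (‖w x‖ ^ 2 + 1 / ((n : ℝ) + 1))) atTop
      (𝓝 (‖w x‖ ^ 2 / (‖w x‖ ^ 2 + 0))) :=
    tendsto_const_nhds.div (tendsto_const_nhds.add tendsto_one_div_add_atTop_nhds_zero_nat) hx'
  rw [add_zero, div_self (by simpa using hx)] at h1
  exact_mod_cast (Complex.continuous_ofReal.tendsto 1).comp h1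

end ApproxInv

section SpectralMeasure

variable {X : Type*} [TopologicalSpace X] [CompactSpace X] [T2Space X] [MeasurableSpace X]
  [BorelSpace X] [HasOuterApproxClosed X]
  {K : Type*} [NormedAddCommGroup K] [InnerProductSpace ℂ K] [CompleteSpace K]
  {Φ : C(X, ℂ) →⋆ₐ[ℂ] (K →L[ℂ] K)} {w : C(X, ℂ)}

/-- Let `T` be the projection of the zero set. Then `‖T Φ(w) f‖² = ∫_{w = 0} |w|² dμ_f = 0`; as `T`
commutes with the injective `Φ(w)`, `T f = 0`, and `μ_f(w = 0) = ‖T f‖²`. -/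
theorem spectralMeasure_zeros (hw : Function.Injective (Φ w)) (f : K) :
    spectralMeasure Φ f {x | w x = 0} = 0 := by
  have hm : MeasurableSet {x | w x = 0} :=
    (isClosed_singleton.preimage w.continuous).measurableSet
  have hT := isSpectralProj_spectralProj Φ hm
  have h0 : spectralMeasure Φ (Φ w f) {x | w x = 0} = 0 := by
    rw [spectralMeasure_starAlgHom_apply, withDensity_apply _ hm]
    refine (setLIntegral_congr_fun hm (g := 0) fun x hx => ?_).trans (by simp)
    have hx : w x = 0 := hx
    simp [hx]
  have h1 := hT.norm_sq hm (Φ w f)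
  rw [measureReal_def, h0, ENNReal.toReal_zero, sq_eq_zero_iff, norm_eq_zero,
    ← mul_apply_eq_comp, (hT.commute w).eq, mul_apply_eq_comp, ← map_zero (Φ w)] at h1
  have h2 := hT.norm_sq hm f
  rw [hw h1, norm_zero, zero_pow two_ne_zero, eq_comm, measureReal_eq_zero_iff] at h2
  exact h2

theorem ae_spectralMeasure_ne_zero (hw : Function.Injective (Φ w)) (f : K) :
    ∀ᵐ x ∂(spectralMeasure Φ f), w x ≠ 0 := by
  rw [ae_iff]
  simpa using spectralMeasure_zeros hw f

theorem tendsto_inner_starAlgHom_approxInv (hw : Function.Injective (Φ w)) (f g : K) :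
    Tendsto (fun n => inner ℂ f (Φ (w * w.approxInv n) g)) atTop (𝓝 (inner ℂ f g)) := by
  refine tendsto_inner_of_tendsto_inner_self (S := 1) (fun h => ?_) f g
  rw [← map_one Φ, ← integral_spectralMeasure]
  simp only [← integral_spectralMeasure]
  refine tendsto_integral_of_dominated_convergence (fun _ => 1)
    (fun n => (w * w.approxInv n).continuous.aestronglyMeasurable) (integrable_const 1)
    (fun n => .of_forall fun x => w.norm_mul_approxInv_le n x) ?_
  filter_upwards [ae_spectralMeasure_ne_zero hw h] with x hx
  exact w.tendsto_mul_approxInv hx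

end SpectralMeasure

namespace ContractionSemigroup

variable {X : Type*} [TopologicalSpace X] [CompactSpace X]
  {K : Type*} [NormedAddCommGroup K] [InnerProductSpace ℂ K] [CompleteSpace K]
  {Q : ContractionSemigroup ℂ K} {Φ : C(X, ℂ) →⋆ₐ[ℂ] (K →L[ℂ] K)} {w : C(X, ℂ)}

theorem op_mul_starAlgHom_approxInv (hw : Φ w = Q.resolvent) (hre : ∀ x, ‖w x‖ ^ 2 ≤ (w x).re)
    (t : ℝ≥0) (n : ℕ) :
    Q.op t * Φ (w * w.approxInv n) = Φ (expMul hre t * w.approxInv n) := by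
  rw [map_mul, map_mul, ← mul_assoc, hw, op_mul_resolvent hw hre]

variable [T2Space X] [MeasurableSpace X] [BorelSpace X] [HasOuterApproxClosed X]

theorem tendsto_inner_starAlgHom_expMul (hw : Φ w = Q.resolvent)
    (hre : ∀ x, ‖w x‖ ^ 2 ≤ (w x).re) (t : ℝ≥0) (f g : K) :
    Tendsto (fun n => inner ℂ f (Φ (expMul hre t * w.approxInv n) g)) atTop
      (𝓝 (inner ℂ f (Q.op t g))) := by
  have hi : Function.Injective (Φ w) := hw ▸ Q.resolvent_injective
  have := tendsto_inner_starAlgHom_approxInv hi ((Q.op t).adjoint f) g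
  simpa only [ContinuousLinearMap.adjoint_inner_left, ← mul_apply_eq_comp,
    op_mul_starAlgHom_approxInv hw hre] using this

theorem commute_op_spectralProj (hw : Φ w = Q.resolvent) (hre : ∀ x, ‖w x‖ ^ 2 ≤ (w x).re)
    (t : ℝ≥0) {Ω : Set X} (hΩ : MeasurableSet Ω) : Commute (Q.op t) (spectralProj Φ Ω) := by
  have hT := isSpectralProj_spectralProj Φ hΩ
  ext g
  refine ext_inner_left ℂ fun f => ?_
  rw [mul_apply_eq_comp, mul_apply_eq_comp, ← hT.inner_left]
  refine tendsto_nhds_unique (tendsto_inner_starAlgHom_expMul hw hre t f (spectralProj Φ Ω g)) ?_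
  refine (tendsto_inner_starAlgHom_expMul hw hre t (spectralProj Φ Ω f) g).congr fun n => ?_
  rw [hT.inner_left, ← mul_apply_eq_comp, (hT.commute _).eq, mul_apply_eq_comp]

theorem ae_norm_exp_le_one (hw : Φ w = Q.resolvent) (hre : ∀ x, ‖w x‖ ^ 2 ≤ (w x).re)
    (t : ℝ≥0) (f : K) : ∀ᵐ x ∂(spectralMeasure Φ f),
      ‖Complex.exp (-((w x)⁻¹ - 1) * ((t : ℝ) : ℂ))‖ ≤ 1 := by
  filter_upwards [ae_spectralMeasure_ne_zero (w := w) (hw ▸ Q.resolvent_injective) f] with x hx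
  exact Complex.norm_exp_neg_inv_sub_one_mul_le hx (hre x) t

theorem integrable_exp_spectralMeasure (hw : Φ w = Q.resolvent)
    (hre : ∀ x, ‖w x‖ ^ 2 ≤ (w x).re) (t : ℝ≥0) (f : K) :
    Integrable (fun x => Complex.exp (-((w x)⁻¹ - 1) * ((t : ℝ) : ℂ))) (spectralMeasure Φ f) := by
  have hwm : Measurable w := w.continuous.measurable
  exact Integrable.of_bound (by fun_prop) 1 (ae_norm_exp_le_one hw hre t f)

theorem inner_op_eq_integral (hw : Φ w = Q.resolvent) (hre : ∀ x, ‖w x‖ ^ 2 ≤ (w x).re)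
    (t : ℝ≥0) (f : K) :
    inner ℂ f (Q.op t f) =
      ∫ x, Complex.exp (-((w x)⁻¹ - 1) * ((t : ℝ) : ℂ)) ∂(spectralMeasure Φ f) := by
  refine tendsto_nhds_unique (tendsto_inner_starAlgHom_expMul hw hre t f f) ?_
  simp only [← integral_spectralMeasure]
  refine tendsto_integral_of_dominated_convergence (fun _ => 1)
    (fun n => (expMul hre t * w.approxInv n).continuous.aestronglyMeasurable) (integrable_const 1)
    (fun n => ?_) ?_
  · filter_upwards [ae_norm_exp_le_one hw hre t f] with x hx
    rw [ContinuousMap.mul_apply, expMul_apply, mul_assoc, norm_mul]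
    exact mul_le_one₀ hx (norm_nonneg _) (w.norm_mul_approxInv_le n x)
  · filter_upwards [ae_spectralMeasure_ne_zero (w := w) (hw ▸ Q.resolvent_injective) f] with x hx
    simp only [ContinuousMap.mul_apply, expMul_apply, mul_assoc]
    simpa using (w.tendsto_mul_approxInv hx).const_mul
      (Complex.exp (-((w x)⁻¹ - 1) * ((t : ℝ) : ℂ)))

end ContractionSemigroup

/-! ### Weak integrals, conjugation and images of resolutions of the identity. -/

namespace ResolutionOfIdentity

section Quadratic

variable {K : Type*} [NormedAddCommGroup K] [InnerProductSpace ℂ K] {F : ResolutionOfIdentity K}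

theorem scalarMeasure_apply (F : ResolutionOfIdentity K) (f g : K) {Ω : Set ℂ}
    (hΩ : MeasurableSet Ω) : F.scalarMeasure f g Ω = inner ℂ g (F.proj Ω f) :=
  if_pos hΩ

variable {ν : K → Measure ℂ}

theorem restrict_scalarMeasure_eq_self
    (hν : ∀ h Ω, MeasurableSet Ω → inner ℂ h (F.proj Ω h) = ((ν h).real Ω : ℂ))
    {S : Set ℂ} (hS : MeasurableSet S) (h0 : ∀ h, ν h Sᶜ = 0) (f g : K) :
    (F.scalarMeasure f g).restrict S = F.scalarMeasure f g := by
  ext Ω hΩ : 1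
  rw [VectorMeasure.restrict_apply _ hS hΩ, F.scalarMeasure_apply f g hΩ,
    F.scalarMeasure_apply f g (hΩ.inter hS)]
  congr 2
  refine ContinuousLinearMap.ext_inner_self fun h => ?_
  rw [hν _ _ hΩ, hν _ _ (hΩ.inter hS), measureReal_def, measureReal_def,
    Set.inter_comm, Measure.measure_inter_eq_of_ae (by rw [ae_iff]; exact h0 h)]

variable [∀ h, IsFiniteMeasure (ν h)]

theorem scalarMeasure_eq_polarization
    (hν : ∀ h Ω, MeasurableSet Ω → inner ℂ h (F.proj Ω h) = ((ν h).real Ω : ℂ)) (f g : K) :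
    F.scalarMeasure f g = (ν (g + f)).complexMulMeasure (1 / 4) +
      (ν (g - f)).complexMulMeasure (-1 / 4) +
      (ν (g + Complex.I • f)).complexMulMeasure (-Complex.I / 4) +
      (ν (g - Complex.I • f)).complexMulMeasure (Complex.I / 4) := by
  ext Ω hΩ : 1
  simp only [add_apply, complexMulMeasure_apply _ _ hΩ, F.scalarMeasure_apply f g hΩ]
  rw [inner_map_polarization_right, hν _ _ hΩ, hν _ _ hΩ, hν _ _ hΩ, hν _ _ hΩ]
  ring

/-- A weak integral is determined by the quadratic forms. -/
theorem isIntegral_of_inner_self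
    (hν : ∀ h Ω, MeasurableSet Ω → inner ℂ h (F.proj Ω h) = ((ν h).real Ω : ℂ))
    {S : Set ℂ} (hS : MeasurableSet S) (h0 : ∀ h, ν h Sᶜ = 0) {m : ℂ → ℂ}
    (hm : ∀ h, Integrable m (ν h)) {T : K →L[ℂ] K}
    (hT : ∀ h, inner ℂ h (T h) = ∫ γ, m γ ∂(ν h)) : F.IsIntegral S m T := by
  refine ⟨hS, fun f g => ?_⟩
  rw [VectorMeasure.IntegrableOn, restrict_scalarMeasure_eq_self hν hS h0,
    scalarMeasure_eq_polarization hν]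
  have i := fun c h => integrable_complexMulMeasure c (hm h)
  have i12 := (i (1 / 4) (g + f)).add_vectorMeasure (i (-1 / 4) (g - f))
  have i123 := i12.add_vectorMeasure (i (-Complex.I / 4) (g + Complex.I • f))
  refine ⟨i123.add_vectorMeasure (i _ _), ?_⟩
  rw [VectorMeasure.integral_add_vectorMeasure i123 (i _ _),
    VectorMeasure.integral_add_vectorMeasure i12 (i _ _),
    VectorMeasure.integral_add_vectorMeasure (i _ _) (i _ _),
    integral_complexMulMeasure _ (hm _), integral_complexMulMeasure _ (hm _),
    integral_complexMulMeasure _ (hm _), integral_complexMulMeasure _ (hm _),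
    inner_map_polarization_right, hT, hT, hT, hT]
  ring

end Quadratic

section Conj

variable {H K : Type*} [NormedAddCommGroup H] [InnerProductSpace ℂ H]
  [NormedAddCommGroup K] [InnerProductSpace ℂ K]

/-- The resolution of the identity `e F e⁻¹`. -/
def conj (F : ResolutionOfIdentity K) (e : K ≃L[ℂ] H) : ResolutionOfIdentity H where
  proj Ω := (e : K →L[ℂ] H) ∘L F.proj Ω ∘L (e.symm : H →L[ℂ] K)
  proj_empty := by simp [F.proj_empty]
  proj_univ := by
    ext
    simp [F.proj_univ]
  proj_inter Ω₁ Ω₂ h₁ h₂ := by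
    ext
    simp [← F.proj_inter Ω₁ Ω₂ h₁ h₂]
  proj_iUnion Ω hΩ hd f := (F.proj_iUnion Ω hΩ hd (e.symm f)).mapL (e : K →L[ℂ] H)

theorem conj_proj_apply (F : ResolutionOfIdentity K) (e : K ≃L[ℂ] H) (Ω : Set ℂ) (f : H) :
    (F.conj e).proj Ω f = e (F.proj Ω (e.symm f)) := rfl

theorem UniformlyBounded.conj {F : ResolutionOfIdentity K} (hF : F.UniformlyBounded)
    (e : K ≃L[ℂ] H) : (F.conj e).UniformlyBounded := by
  obtain ⟨M, hM⟩ := hF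
  refine ⟨‖(e : K →L[ℂ] H)‖ * (M * ‖(e.symm : H →L[ℂ] K)‖), fun Ω hΩ => ?_⟩
  refine (ContinuousLinearMap.opNorm_comp_le _ _).trans ?_
  gcongr
  refine (ContinuousLinearMap.opNorm_comp_le _ _).trans ?_
  gcongr
  exact hM Ω hΩ

theorem scalarMeasure_conj [CompleteSpace H] [CompleteSpace K] (F : ResolutionOfIdentity K)
    (e : K ≃L[ℂ] H) (f g : H) : (F.conj e).scalarMeasure f g =
      F.scalarMeasure (e.symm f) ((e : K →L[ℂ] H).adjoint g) := by
  ext Ω hΩ : 1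
  rw [scalarMeasure_apply _ _ _ hΩ, scalarMeasure_apply _ _ _ hΩ,
    ContinuousLinearMap.adjoint_inner_left]
  rfl

theorem IsIntegral.conj [CompleteSpace H] [CompleteSpace K] {F : ResolutionOfIdentity K}
    {S : Set ℂ} {m : ℂ → ℂ} {T : K →L[ℂ] K} (h : F.IsIntegral S m T) (e : K ≃L[ℂ] H) :
    (F.conj e).IsIntegral S m ((e : K →L[ℂ] H) ∘L T ∘L (e.symm : H →L[ℂ] K)) := by
  refine ⟨h.1, fun f g => ?_⟩
  obtain ⟨h1, h2⟩ := h.2 (e.symm f) ((e : K →L[ℂ] H).adjoint g)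
  rw [scalarMeasure_conj]
  refine ⟨h1, ?_⟩
  rw [← h2, ContinuousLinearMap.adjoint_inner_left]
  rfl

end Conj

section Spectral

variable {X : Type*} [TopologicalSpace X] [CompactSpace X] [T2Space X] [MeasurableSpace X]
  [BorelSpace X] [HasOuterApproxClosed X]
  {K : Type*} [NormedAddCommGroup K] [InnerProductSpace ℂ K] [CompleteSpace K]

/-- The image under `γ : X → ℂ` of the projection-valued measure of a star homomorphism. -/
def ofStarAlgHom (Φ : C(X, ℂ) →⋆ₐ[ℂ] (K →L[ℂ] K)) {γ : X → ℂ} (hγ : Measurable γ) :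
    ResolutionOfIdentity K where
  proj Ω := spectralProj Φ (γ ⁻¹' Ω)
  proj_empty := (isSpectralProj_spectralProj Φ (hγ .empty)).eq isSpectralProj_empty
  proj_univ := (isSpectralProj_spectralProj Φ (hγ .univ)).eq isSpectralProj_univ
  proj_inter Ω₁ Ω₂ h₁ h₂ :=
    ((isSpectralProj_spectralProj Φ (hγ h₁)).mul (isSpectralProj_spectralProj Φ (hγ h₂))
      (hγ h₁) (hγ h₂)).eq (isSpectralProj_spectralProj Φ (hγ (h₁.inter h₂)))
  proj_iUnion Ω hΩ hd f := by
    rw [Set.preimage_iUnion]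
    exact hasSum_spectralProj Φ (fun i => hγ (hΩ i)) (fun i j hij => (hd hij).preimage γ) f

theorem uniformlyBounded_ofStarAlgHom (Φ : C(X, ℂ) →⋆ₐ[ℂ] (K →L[ℂ] K)) {γ : X → ℂ}
    (hγ : Measurable γ) : (ofStarAlgHom Φ hγ).UniformlyBounded :=
  ⟨1, fun _ hΩ => (isSpectralProj_spectralProj Φ (hγ hΩ)).norm_le_one⟩

end Spectral

end ResolutionOfIdentity

/-! ### Normal semigroups and their conjugates are scalar spectral. -/

namespace ContractionSemigroup

theorem measurableSet_operatorSpectrum {H : Type*} [NormedAddCommGroup H] [InnerProductSpace ℂ H]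
    [CompleteSpace H] (P : ContractionSemigroup ℂ H) :
    MeasurableSet (operatorSpectrum P.operatorA) := by
  rw [P.operatorSpectrum_operatorA]
  have hm : Measurable fun z : ℂ => (z + 1)⁻¹ := by fun_prop
  exact (measurableSet_singleton (-1 : ℂ)).compl.inter
    (hm (spectrum.isClosed (𝕜 := ℂ) P.resolvent).measurableSet)

variable {K : Type*} [NormedAddCommGroup K] [InnerProductSpace ℂ K] [CompleteSpace K]

/-- The contraction `2 R - 1` has spectrum in the unit disc, and `‖2z - 1‖ ≤ 1` is the same as `‖z‖²
≤ Re z`. -/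
theorem norm_sq_le_re_of_mem_spectrum_resolvent (Q : ContractionSemigroup ℂ K) {z : ℂ}
    (hz : z ∈ spectrum ℂ Q.resolvent) : ‖z‖ ^ 2 ≤ z.re := by
  rcases subsingleton_or_nontrivial K with hK | hK
  · simp at hz
  have h1 : 2 * z - 1 ∈ spectrum ℂ ((2 : ℂ) • Q.resolvent - 1) := by
    have h0 : (2 : ℂ) * z ∈ spectrum ℂ ((2 : ℂ) • Q.resolvent) :=
      (spectrum.smul_mem_smul_iff (r := Units.mk0 (2 : ℂ) two_ne_zero)).2 hz
    have h3 : (2 : ℂ) * z - 1 ∈ spectrum ℂ ((2 : ℂ) • Q.resolvent - algebraMap ℂ _ 1) := by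
      rw [← spectrum.sub_singleton_eq]
      exact Set.sub_mem_sub h0 rfl
    rwa [map_one] at h3
  have h2 := (spectrum.norm_le_norm_of_mem h1).trans Q.norm_two_smul_resolvent_sub_one_le
  have h3 : ‖2 * z - 1‖ ^ 2 ≤ 1 := pow_le_one₀ (norm_nonneg _) h2
  rw [← Complex.normSq_eq_norm_sq, Complex.normSq_apply] at *
  simp at h3
  nlinarith

theorem IsNormal.isScalarSpectral {Q : ContractionSemigroup ℂ K} (hQ : Q.IsNormal) :
    Q.IsScalarSpectral := by
  have hR := hQ.isStarNormal_resolvent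
  let Φ : C(spectrum ℂ Q.resolvent, ℂ) →⋆ₐ[ℂ] (K →L[ℂ] K) := cfcHom hR
  let w : C(spectrum ℂ Q.resolvent, ℂ) := .restrict (spectrum ℂ Q.resolvent) (.id ℂ)
  have hw : Φ w = Q.resolvent := cfcHom_id hR
  have hre : ∀ x, ‖w x‖ ^ 2 ≤ (w x).re := fun x =>
    Q.norm_sq_le_re_of_mem_spectrum_resolvent x.2
  have hγ : Measurable fun x => (w x)⁻¹ - 1 := by
    have : Measurable w := w.continuous.measurable
    fun_prop
  refine ⟨.ofStarAlgHom Φ hγ, ⟨ResolutionOfIdentity.uniformlyBounded_ofStarAlgHom Φ hγ,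
    fun t Ω hΩ => commute_op_spectralProj hw hre t (hγ hΩ)⟩, fun t => ?_⟩
  have hm : Measurable fun γ : ℂ => Complex.exp (-γ * ((t : ℝ) : ℂ)) := by fun_prop
  refine ResolutionOfIdentity.isIntegral_of_inner_self
    (ν := fun h => (spectralMeasure Φ h).map fun x => (w x)⁻¹ - 1)
    (fun h Ω hΩ => ?_) Q.measurableSet_operatorSpectrum (fun h => ?_) (fun h => ?_) fun h => ?_
  · rw [map_measureReal_apply hγ hΩ]
    exact (isSpectralProj_spectralProj Φ (hγ hΩ)).inner_self h
  -- Points with `w x ≠ 0` are sent into `σ(A)`. Only the zeros of `w`, sent to `-1` by the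
  -- convention `0⁻¹ = 0`, can miss it, and they form a null set.
  · rw [Measure.map_apply hγ Q.measurableSet_operatorSpectrum.compl]
    refine measure_mono_null (fun x hx => ?_)
      (spectralMeasure_zeros (w := w) (by rw [hw]; exact Q.resolvent_injective) h)
    by_contra hx0
    refine hx ?_
    rw [Q.operatorSpectrum_operatorA]
    have hx0 : w x ≠ 0 := hx0
    refine ⟨fun h1 => inv_ne_zero hx0 (by linear_combination h1), ?_⟩
    rw [sub_add_cancel, inv_inv]
    exact x.2
  · rw [integrable_map_measure hm.aestronglyMeasurable hγ.aemeasurable]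
    exact integrable_exp_spectralMeasure hw hre t h
  · rw [integral_map hγ.aemeasurable hm.aestronglyMeasurable]
    exact inner_op_eq_integral hw hre t h

variable {H : Type*} [NormedAddCommGroup H] [InnerProductSpace ℂ H] [CompleteSpace H]

theorem SimilarVia.isScalarSpectral {P : ContractionSemigroup ℂ H} {Q : ContractionSemigroup ℂ K}
    {Λ : K →L[ℂ] H} (h : P.SimilarVia Q Λ) (hQ : Q.IsScalarSpectral) : P.IsScalarSpectral := by
  obtain ⟨e, -, -, he⟩ := h.exists_equiv
  obtain ⟨F, ⟨hb, hc⟩, hF⟩ := hQ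
  have hP : ∀ t, P.op t = (e : K →L[ℂ] H) ∘L Q.op t ∘L (e.symm : H →L[ℂ] K) := fun t => by
    ext f
    simpa using he t (e.symm f)
  have hS : operatorSpectrum P.operatorA = operatorSpectrum Q.operatorA := by
    rw [P.operatorSpectrum_operatorA, Q.operatorSpectrum_operatorA, spectrum_resolvent_eq he]
  refine ⟨F.conj e, ⟨hb.conj e, fun t Ω hΩ => ?_⟩, fun t => ?_⟩
  · ext f
    have := DFunLike.congr_fun (hc t Ω hΩ).eq (e.symm f)
    simpa [hP, ResolutionOfIdentity.conj_proj_apply] using this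
  · rw [hS, hP]
    exact (hF t).conj e

end ContractionSemigroup

end

theorem mainTheorem5 :
    (∀ {𝕜 H K : Type*} [RCLike 𝕜]
      [NormedAddCommGroup H] [InnerProductSpace 𝕜 H] [CompleteSpace H]
      [NormedAddCommGroup K] [InnerProductSpace 𝕜 K] [CompleteSpace K]
      (P : ContractionSemigroup 𝕜 H) (Q : ContractionSemigroup 𝕜 K) (Λ : K →L[𝕜] H),
      P.SimilarVia Q Λ →
        (∀ r : ℝ≥0 → ℝ, Q.ConvergesWithRate r →
          P.ConvergesWithRate (fun t => conditionNumber Λ * r t)) ∧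
        (Nontrivial H → ∀ C γ : ℝ, Q.Hypocoercive C γ →
          P.Hypocoercive (C * conditionNumber Λ) γ)) ∧
    (∀ {H K : Type*}
      [NormedAddCommGroup H] [InnerProductSpace ℂ H] [CompleteSpace H]
      [NormedAddCommGroup K] [InnerProductSpace ℂ K] [CompleteSpace K]
      (P : ContractionSemigroup ℂ H) (Q : ContractionSemigroup ℂ K) (Λ : K →L[ℂ] H),
      P.SimilarVia Q Λ → Q.IsNormal → P.IsScalarSpectral) := by
  refine ⟨fun P Q Λ h => ⟨fun r hr => h.convergesWithRate hr, fun _ C γ hQ => h.hypocoercive hQ⟩,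
    fun P Q Λ h hQ => h.isScalarSpectral hQ.isScalarSpectral⟩
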